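/- Fix an integer $p\ge 2$ and let $\sigma_p$ be the surface measure on the unit sphere $\mathcal S^{p-1}\subset\mathbb R^p$; put $\theta_0=(0,\dots,0,1)'$, and let $\omega_{p-2}=2\pi^{(p-1)/2}/\Gamma(\tfrac{p-1}{2})$ be the surface area of $\mathcal S^{p-2}$. *Polynomials.* For $\lambda>0$ let $C_q^\lambda(t)=\sum_{j=0}^{\lfloor q/2\rfloor}(-1)^j\frac{2^{q-2j}\Gamma(q-j+\lambda)}{\Gamma(\lambda)\,j!\,(q-2j)!}t^{q-2j}$ be the Gegenbauer polynomial, and let $C_q^0$ be the Chebyshev polynomial of the first kind, $C_q^0(\cos\theta)=\cos(q\theta)$. *Basis of spherical harmonics.* Write $\mathbf x\in\mathcal S^{p-1}$ in hyperspherical coordinates, $x_1=\sin\theta_{p-1}\cdots\sin\theta_1$ and $x_i=\sin\theta_{p-1}\cdots\sin\theta_i\cos\theta_{i-1}$ for $2\le i\le p$, with $0\le\theta_1<2\pi$ and $0\le\theta_j\le\pi$ for $2\le j\le p-1$. For $k\ge 0$ let $\mathcal M_k=\{\mathbf m\in\mathbb N_0^p: m_1+\dots+m_p=k,\ m_p\in\{0,1\}\}$;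 for $k\ge1$ it has $d_{p,k}=\binom{p+k-3}{p-2}+\binom{p+k-2}{p-2}$ elements. For $\mathbf m\in\mathcal M_k$ let $|\mathbf m^j|=m_j+\dots+m_p$, $\lambda_j=|\mathbf m^{j+1}|+(p-j-1)/2$, $\zeta_{\mathbf m}(s)=\cos(m_{p-1}s)$ if $m_p=0$ and $\zeta_{\mathbf m}(s)=\sin((m_{p-1}+1)s)$ if $m_p=1$, and $$B_{\mathbf m}=b_{\mathbf m}\prod_{j=1}^{p-2}\frac{m_j!\,(\frac{p-j+1}{2})_{|\mathbf m^{j+1}|}(m_j+\lambda_j)}{(2\lambda_j)_{m_j}(\frac{p-j}{2})_{|\mathbf m^{j+1}|}\lambda_j},$$ with $(a)_k=a(a+1)\cdots(a+k-1)$, $b_{\mathbf m}=2$ if $m_{p-1}+m_p>0$ and $b_{\mathbf m}=1$ otherwise. Put $$\varphi_{\mathbf m}(\mathbf x)=\sqrt{B_{\mathbf m}}\;\zeta_{\mathbf m}(\theta_1)\prod_{j=1}^{p-2}(\sin\theta_{p-j})^{|\mathbf m^{j+1}|}\,C_{m_j}^{\lambda_j}(\cos\theta_{p-j}).$$ (For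 $p=2$ and $k\ge1$ these are $\sqrt2\cos(k\theta_1)$ and $\sqrt2\sin(k\theta_1)$; for $k=0$ the only one is the constant $1$.) Let $\mathbf G_{p,k}=(\varphi_{\mathbf m})_{\mathbf m\in\mathcal M_k}$, regarded as a vector whose first component is the one with $\mathbf m=(k,0,\dots,0)$, let $\mathbf e_1$ be the corresponding first canonical basis vector, and let $t_{p,k}=\sqrt2$ if $p=2$ and $t_{p,k}=(1+2k/(p-2))/\sqrt{d_{p,k}}$ if $p\ge3$. *Alternatives.* Let $f:\mathbb R\to[0,\infty)$ be measurable with $f(0)=1$ and continuous at $0$, and let $(\kappa_n)$ be a sequence of positive reals with $\kappa_n\to0$. Let $\mathrm P_n$ be the law on $\mathcal S^{p-1}$ with density $$\mathbf u\mapsto c_n f(\kappa_n\mathbf u'\theta_0),\qquad c_n=1\Big/\int_{-1}^1(1-s^2)^{(p-3)/2}f(\kappa_n s)\,ds,$$ with respect to $\sigma_p/\omega_{p-2}$, and let $\mathbf U$ have law $\mathrm P_n$ (expectation $\mathrm E_n$, covariance matrix $\mathrm{Var}_n$). **Proposition.** Let $k$ be a positive integer. The law $\mathrm P_n$ is a well-defined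 probability measure for all large $n$. For every $n$ for which it is, all components of the vectors $\mathbf G_{p,\ell}(\mathbf U)$, $\ell\ge0$, are square-integrable and $$\mathrm E_n[\mathbf G_{p,k}(\mathbf U)]=t_{p,k}\,\mathrm E_n\big[C_k^{(p-2)/2}(\mathbf U'\theta_0)\big]\,\mathbf e_1 .$$ Moreover, as $n\to\infty$, $$\mathrm{Var}_n[\mathbf G_{p,k}(\mathbf U)]=\mathbf I_{d_{p,k}}+o(1),\qquad \mathrm E_n\big[\mathbf G_{p,k}(\mathbf U)\,\mathbf G_{p,\ell}(\mathbf U)'\big]=o(1)\quad\text{for every integer }\ell\ge0,\ \ell\ne k .$$ -/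

import Mathlib

open MeasureTheory ProbabilityTheory Filter Topology

noncomputable section

namespace SphereMoments

/-- The `i`-th entry `v_i` of `v = (v_1, …, v_p)`, counted from one (zero outside `1, …, p`). -/
def ent {α : Type*} [Zero α] {p : ℕ} (v : Fin p → α) (i : ℕ) : α :=
  if h : 1 ≤ i ∧ i ≤ p then v ⟨i - 1, by omega⟩ else 0

/-- The unit sphere `S^{p-1}` of `ℝ^p`. -/
abbrev USphere (p : ℕ) : Type :=
  Metric.sphere (0 : EuclideanSpace ℝ (Fin p)) 1

/-! ### Hyperspherical coordinates -/

/-- The `i`-th coordinate `x_i`, `1 ≤ i ≤ p`, of the point of `S^{p-1}` with hyperspherical angles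
`θ_1, …, θ_{p-1}`: `x_1 = sin θ_{p-1} ⋯ sin θ_1` and
`x_i = sin θ_{p-1} ⋯ sin θ_i cos θ_{i-1}` for `i ≥ 2`. -/
def hyperPoint (p : ℕ) (θ : ℕ → ℝ) (i : ℕ) : ℝ :=
  (if i = 1 then 1 else Real.cos (θ (i - 1))) * ∏ l ∈ Finset.Icc i (p - 1), Real.sin (θ l)

/-- `(x_1 ^ 2 + ⋯ + x_i ^ 2)^{1/2}`. -/
def partialRadius {p : ℕ} (x : EuclideanSpace ℝ (Fin p)) (i : ℕ) : ℝ :=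
  √(∑ l ∈ Finset.Icc 1 i, ent (fun a => x a) l ^ 2)

/-- The hyperspherical angles `θ_1 ∈ [0, 2π)` and `θ_j ∈ [0, π]`, `2 ≤ j ≤ p - 1`, of `x`.
See `hyperPoint_angle` below. -/
def angle {p : ℕ} (x : EuclideanSpace ℝ (Fin p)) (j : ℕ) : ℝ :=
  if j = 1 then
    toIcoMod Real.two_pi_pos 0 (Complex.arg ⟨ent (fun a => x a) 2, ent (fun a => x a) 1⟩)
  else Real.arccos (ent (fun a => x a) (j + 1) / partialRadius x (j + 1))

theorem partialRadius_sq {p : ℕ} (x : EuclideanSpace ℝ (Fin p)) (i : ℕ) :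
    partialRadius x i ^ 2 = ∑ l ∈ Finset.Icc 1 i, ent (fun a => x a) l ^ 2 :=
  Real.sq_sqrt (Finset.sum_nonneg fun _ _ => sq_nonneg _)

theorem partialRadius_succ_sq {p : ℕ} (x : EuclideanSpace ℝ (Fin p)) (i : ℕ) :
    partialRadius x (i + 1) ^ 2 = partialRadius x i ^ 2 + ent (fun a => x a) (i + 1) ^ 2 := by
  rw [partialRadius_sq, partialRadius_sq, Finset.sum_Icc_succ_top (by omega)]

theorem partialRadius_nonneg {p : ℕ} (x : EuclideanSpace ℝ (Fin p)) (i : ℕ) :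
    0 ≤ partialRadius x i := Real.sqrt_nonneg _

theorem partialRadius_top {p : ℕ} (x : USphere p) : partialRadius x.1 p = 1 := by
  have h : ‖x.1‖ = 1 := by simp
  refine Eq.trans ?_ h
  rw [EuclideanSpace.norm_eq, partialRadius]
  congr 1
  rw [← Finset.sum_attach]
  refine Finset.sum_bij' (fun l _ => (⟨l.1 - 1, by have := Finset.mem_Icc.1 l.2; omega⟩ : Fin p))
    (fun a _ => ⟨a.1 + 1, Finset.mem_Icc.2 ⟨by omega, by omega⟩⟩) ?_ ?_ ?_ ?_ ?_
  · simp
  · simp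
  · rintro ⟨l, hl⟩ _
    simp at hl ⊢
    omega
  · simp
  · rintro ⟨l, hl⟩ _
    simp at hl
    simp [ent, hl]

theorem partialRadius_mul_cos {p : ℕ} (x : EuclideanSpace ℝ (Fin p)) {j : ℕ} (hj : 2 ≤ j) :
    partialRadius x (j + 1) * Real.cos (angle x j) = ent (fun a => x a) (j + 1) ∧
      partialRadius x (j + 1) * Real.sin (angle x j) = partialRadius x j := by
  have hs := partialRadius_succ_sq x j
  have h0 := partialRadius_nonneg x j
  have h1 := partialRadius_nonneg x (j + 1)
  generalize partialRadius x j = r at *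
  rw [angle, if_neg (by omega)]
  generalize partialRadius x (j + 1) = R at *
  generalize ent (fun a => x a) (j + 1) = y at *
  rcases h1.eq_or_lt with h | h
  · subst h
    have hr : r = 0 := by nlinarith [sq_nonneg y]
    have hy : y = 0 := by subst hr; simpa using hs.symm
    simp [hr, hy]
  · have hle : |y| ≤ R := abs_le_of_sq_le_sq (by nlinarith [sq_nonneg r]) h1
    have h2 := abs_le.1 hle
    constructor
    · rw [Real.cos_arccos (by rw [le_div_iff₀ h]; linarith) (by rw [div_le_iff₀ h]; linarith)]
      field_simp
    · rw [Real.sin_arccos]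
      have : 1 - (y / R) ^ 2 = (r / R) ^ 2 := by
        field_simp
        linarith
      rw [this, Real.sqrt_sq (by positivity)]
      field_simp

/-- `angle x` are hyperspherical angles of the point `x` of the sphere. -/
theorem hyperPoint_angle {p : ℕ} (hp : 2 ≤ p) (x : USphere p) :
    angle x.1 1 ∈ Set.Ico 0 (2 * Real.pi) ∧
    (∀ j ∈ Finset.Icc 2 (p - 1), angle x.1 j ∈ Set.Icc 0 Real.pi) ∧
    ∀ i ∈ Finset.Icc 1 p, hyperPoint p (angle x.1) i = ent (fun a => x.1 a) i := by
  refine ⟨?_, ?_, ?_⟩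
  · have := toIcoMod_mem_Ico Real.two_pi_pos 0
      (Complex.arg ⟨ent (fun a => x.1 a) 2, ent (fun a => x.1 a) 1⟩)
    simpa [angle] using this
  · intro j hj
    simp at hj
    rw [angle, if_neg (by omega)]
    exact ⟨Real.arccos_nonneg _, Real.arccos_le_pi _⟩
  · have hprod : ∀ i, 2 ≤ i → i ≤ p →
        ∏ l ∈ Finset.Icc i (p - 1), Real.sin (angle x.1 l) = partialRadius x.1 i := by
      intro i h2 hi
      induction hi using Nat.decreasingInduction with
      | self =>
        rw [Finset.Icc_eq_empty (by omega), Finset.prod_empty, partialRadius_top]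
      | of_succ i hi ih =>
        rw [← Finset.mul_prod_Ioc_eq_prod_Icc (by omega : i ≤ p - 1),
          ← Finset.Icc_succ_left_eq_Ioc, Nat.succ_eq_succ, Nat.succ_eq_add_one, ih (by omega), mul_comm]
        exact (partialRadius_mul_cos x.1 h2).2
    have hz : (⟨ent (fun a => x.1 a) 2, ent (fun a => x.1 a) 1⟩ : ℂ) =
        partialRadius x.1 2 * (Real.cos (angle x.1 1) + Real.sin (angle x.1 1) * Complex.I) := by
      set z : ℂ := ⟨ent (fun a => x.1 a) 2, ent (fun a => x.1 a) 1⟩ with hzdef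
      have hn : ‖z‖ = partialRadius x.1 2 := by
        rw [Complex.norm_def, Complex.normSq_apply, partialRadius, hzdef]
        congr 1
        rw [Finset.sum_Icc_succ_top (by omega)]
        simp
        ring
      have ha : angle x.1 1 = z.arg - toIcoDiv Real.two_pi_pos 0 z.arg * (2 * Real.pi) := by
        rw [angle, if_pos rfl, toIcoMod, zsmul_eq_mul]
      rw [ha, Real.cos_sub_int_mul_two_pi, Real.sin_sub_int_mul_two_pi, ← hn]
      push_cast
      exact (Complex.norm_mul_cos_add_sin_mul_I z).symm
    have hre := congrArg Complex.re hz
    have him := congrArg Complex.im hz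
    simp [-Complex.ofReal_cos, -Complex.ofReal_sin] at hre him
    intro i hi
    simp at hi
    rcases Nat.lt_trichotomy i 2 with h | h | h
    · have : i = 1 := by omega
      subst this
      rw [hyperPoint, if_pos rfl, ← Finset.mul_prod_Ioc_eq_prod_Icc (by omega : 1 ≤ p - 1),
        ← Finset.Icc_succ_left_eq_Ioc, Nat.succ_eq_succ, Nat.succ_eq_add_one, hprod 2 le_rfl hp, him]
      ring
    · subst h
      rw [hyperPoint, if_neg (by omega), hprod 2 le_rfl hp, hre]
      ring
    · obtain ⟨j, rfl⟩ : ∃ j, i = j + 1 := ⟨i - 1, by omega⟩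
      rw [hyperPoint, if_neg (by omega), hprod _ (by omega) hi.2, Nat.add_sub_cancel, mul_comm]
      exact (partialRadius_mul_cos x.1 (by omega)).1

/-! ### Gegenbauer polynomials and the basis of spherical harmonics -/

/-- `C_q^lam(t)`: the Gegenbauer polynomial of degree `q` if `lam > 0`, and the Chebyshev
polynomial of the first kind of degree `q` if `lam = 0`. -/
def gegenbauer (lam : ℝ) (q : ℕ) (t : ℝ) : ℝ :=
  if lam = 0 then (Polynomial.Chebyshev.T ℝ q).eval t
  else ∑ j ∈ Finset.range (q / 2 + 1),
    (-1) ^ j * (2 ^ (q - 2 * j) * Real.Gamma ((q - j : ℕ) + lam) /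
      (Real.Gamma lam * j.factorial * (q - 2 * j).factorial)) * t ^ (q - 2 * j)

/-- The Pochhammer symbol `(a)_k = a (a + 1) ⋯ (a + k - 1)`. -/
def poch (a : ℝ) (k : ℕ) : ℝ := (ascPochhammer ℝ k).eval a

/-- The dimension `d_{p,k}` of the space of spherical harmonics of degree `k ≥ 1` on `S^{p-1}`,
`p ≥ 2`. -/
def harmDim (p k : ℕ) : ℕ :=
  (p + k - 3).choose (p - 2) + (p + k - 2).choose (p - 2)

/-- The set of multi-indices `m ∈ ℕ^p` with `m_1 + ⋯ + m_p = k` and `m_p ∈ {0, 1}`; it indexes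
the basis of spherical harmonics of degree `k`. -/
abbrev HarmIndex (p k : ℕ) : Type :=
  {m : Fin p → ℕ // ∑ i, m i = k ∧ ent m p ≤ 1}

theorem ent_last {p : ℕ} (m : Fin (p+1) → ℕ) : ent m (p+1) = m (Fin.last p) := by
  simp [ent, Fin.last]

theorem card_sum_eq (n k : ℕ) :
    Nat.card {m : Fin (n + 1) → ℕ // ∑ i, m i = k} = (n + k).choose n := by
  rw [Nat.card_congr (Sym.equivNatSumOfFintype (Fin (n + 1)) k).symm, Nat.card_eq_fintype_card,
    Sym.card_sym_eq_choose, Fintype.card_fin]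
  rw [show n + 1 + k - 1 = n + k by omega, Nat.choose_symm_add]

/-- There are `d_{p,k}` indices, so that vectors indexed by `HarmIndex p k` form `ℝ^{d_{p,k}}`. -/
theorem card_harmIndex {p k : ℕ} (hp : 2 ≤ p) (hk : 1 ≤ k) :
    Nat.card (HarmIndex p k) = harmDim p k := by
  obtain ⟨n, rfl⟩ : ∃ n, p = n + 2 := ⟨p - 2, by omega⟩
  let e : HarmIndex (n + 2) k ≃
      {m : Fin (n + 1) → ℕ // ∑ i, m i = k - 1} ⊕ {m : Fin (n + 1) → ℕ // ∑ i, m i = k} :=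
    { toFun := fun m =>
        if h : m.1 (Fin.last _) = 0 then
          Sum.inr ⟨Fin.init m.1, by
            have := m.2.1
            rw [Fin.sum_univ_castSucc, h] at this
            simpa [Fin.init] using this⟩
        else Sum.inl ⟨Fin.init m.1, by
            have := m.2.1
            have h2 := m.2.2
            rw [Fin.sum_univ_castSucc] at this
            rw [ent_last] at h2
            simp only [Fin.init]
            omega⟩
      invFun := Sum.elim
        (fun m => ⟨Fin.snoc m.1 1, by
          rw [Fin.sum_univ_castSucc]; simp [m.2]; omega, by simp [ent_last]⟩)
        (fun m => ⟨Fin.snoc m.1 0, by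
          rw [Fin.sum_univ_castSucc]; simp [m.2], by simp [ent_last]⟩)
      left_inv := by
        rintro ⟨m, h1, h2⟩
        rw [ent_last] at h2
        by_cases h : m (Fin.last _) = 0
        · simp only [h, dite_true, Sum.elim_inr, Subtype.mk.injEq]
          rw [← h, Fin.snoc_init_self]
        · have h3 : m (Fin.last _) = 1 := by omega
          simp only [h, dite_false, Sum.elim_inl, Subtype.mk.injEq]
          exact (congrArg (Fin.snoc (Fin.init m)) h3.symm).trans (Fin.snoc_init_self m)
      right_inv := by
        rintro (m | m) <;> simp }
  have : ∀ k, Finite {m : Fin (n + 1) → ℕ // ∑ i, m i = k} := fun k =>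
    Finite.of_equiv _ (Sym.equivNatSumOfFintype (Fin (n + 1)) k)
  rw [Nat.card_congr e, Nat.card_sum, card_sum_eq, card_sum_eq, harmDim]
  congr 2 <;> omega

/-- The first multi-index `(k, 0, …, 0)`. -/
def firstIndex {p : ℕ} (hp : 2 ≤ p) (k : ℕ) : HarmIndex p k :=
  ⟨Pi.single ⟨0, by omega⟩ k, by simp, by
    rw [ent, dif_pos ⟨by omega, le_rfl⟩, Pi.single_eq_of_ne]
    · omega
    · simp [Fin.ext_iff]; omega⟩

/-- `|m^j| = m_j + ⋯ + m_p`. -/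
def tailSum {p : ℕ} (m : Fin p → ℕ) (j : ℕ) : ℕ := ∑ i ∈ Finset.Icc j p, ent m i

/-- `λ_j = |m^{j+1}| + (p - j - 1) / 2`. -/
def lamIdx {p : ℕ} (m : Fin p → ℕ) (j : ℕ) : ℝ :=
  (tailSum m (j + 1) : ℝ) + ((p : ℝ) - j - 1) / 2

/-- `ζ_m(s)`: `cos (m_{p-1} s)` if `m_p = 0`, and `sin ((m_{p-1} + 1) s)` if `m_p = 1`. -/
def zeta {p : ℕ} (m : Fin p → ℕ) (s : ℝ) : ℝ :=
  if ent m p = 0 then Real.cos (ent m (p - 1) * s) else Real.sin ((ent m (p - 1) + 1) * s)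

/-- The squared normalization constant `B_m`. -/
def normB {p : ℕ} (m : Fin p → ℕ) : ℝ :=
  (if 0 < ent m (p - 1) + ent m p then 2 else 1) *
    ∏ j ∈ Finset.Icc 1 (p - 2),
      ((ent m j).factorial * poch (((p : ℝ) - j + 1) / 2) (tailSum m (j + 1)) *
          (ent m j + lamIdx m j)) /
        (poch (2 * lamIdx m j) (ent m j) * poch (((p : ℝ) - j) / 2) (tailSum m (j + 1)) *
          lamIdx m j)

/-- The basis function `φ_m` on the sphere, in hyperspherical coordinates. For `p = 2` the product
is empty; see `harmBasis_two_fst` and `harmBasis_two_snd`. -/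
def harmBasis {p : ℕ} (m : Fin p → ℕ) (x : USphere p) : ℝ :=
  √(normB m) * zeta m (angle x.1 1) *
    ∏ j ∈ Finset.Icc 1 (p - 2),
      Real.sin (angle x.1 (p - j)) ^ tailSum m (j + 1) *
        gegenbauer (lamIdx m j) (ent m j) (Real.cos (angle x.1 (p - j)))

/-- The vector `G_{p,k}(x)` of all basis functions of degree `k`; its first component is the one
with index `firstIndex`. -/
def harmVec (p k : ℕ) (x : USphere p) : HarmIndex p k → ℝ := fun m => harmBasis m.1 x

theorem harmBasis_two_fst {k : ℕ} (hk : 1 ≤ k) (x : USphere 2) :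
    harmBasis ![k, 0] x = √2 * Real.cos (k * angle x.1 1) := by
  simp [harmBasis, normB, zeta, ent, show 0 < k by omega]

theorem harmBasis_two_snd {k : ℕ} (hk : 1 ≤ k) (x : USphere 2) :
    harmBasis ![k - 1, 1] x = √2 * Real.sin (k * angle x.1 1) := by
  simp [harmBasis, normB, zeta, ent, Nat.cast_sub hk]

/-- `t_{p,k}`. -/
def tCoef (p k : ℕ) : ℝ :=
  if p = 2 then √2 else (1 + 2 * (k : ℝ) / ((p : ℝ) - 2)) / √(harmDim p k)

/-! ### Rotationally symmetric distributions -/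

/-- The surface area measure `σ_p` on `S^{p-1}`. -/
def surfaceMeasure (p : ℕ) : Measure (USphere p) :=
  (volume : Measure (EuclideanSpace ℝ (Fin p))).toSphere

/-- The surface area `ω_{d-1} = 2 π^{d/2} / Γ(d/2)` of the unit sphere `S^{d-1}` of `ℝ^d`. -/
def sphereArea (d : ℕ) : ℝ := 2 * Real.pi ^ ((d : ℝ) / 2) / Real.Gamma ((d : ℝ) / 2)

/-- The normalizing constant `c_{p,κ,f}`. -/
def normConst (p : ℕ) (κ : ℝ) (f : ℝ → ℝ) : ℝ :=
  1 / ∫ s in (-1 : ℝ)..1, (1 - s ^ 2) ^ (((p : ℝ) - 3) / 2) * f (κ * s)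

/-- The rotationally symmetric law on `S^{p-1}` with location `θ`, concentration `κ` and angular
function `f`: it has density `u ↦ c_{p,κ,f} f(κ u'θ)` with respect to `σ_p / ω_{p-2}`, the
reference measure that makes `c_{p,κ,f}` the normalizing constant. -/
def rotSymm (p : ℕ) (θ : EuclideanSpace ℝ (Fin p)) (κ : ℝ) (f : ℝ → ℝ) : Measure (USphere p) :=
  ((ENNReal.ofReal (sphereArea (p - 1)))⁻¹ • surfaceMeasure p).withDensity
    fun u => ENNReal.ofReal (normConst p κ f * f (κ * inner ℝ u.1 θ))

/-- `θ_0 = (0, …, 0, 1)'`. -/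
def poleVec (p : ℕ) : EuclideanSpace ℝ (Fin p) :=
  WithLp.toLp 2 fun i => if (i : ℕ) + 1 = p then 1 else 0

/-- An angular function: `f : ℝ → [0, ∞)` measurable with `f 0 = 1`. -/
structure IsAngular (f : ℝ → ℝ) : Prop where
  measurable : Measurable f
  nonneg : ∀ s, 0 ≤ f s
  at_zero : f 0 = 1

/-- The law of each observation under `P^{(n)}_{κ_n, f}`, with `κ = κ_n`. -/
def altLaw (p : ℕ) (κ : ℝ) (f : ℝ → ℝ) : Measure (USphere p) := rotSymm p (poleVec p) κ f

/-- The mean vector `E[G_{p,k}(U)]` for `U` with law `P`. -/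
def meanVec (p k : ℕ) (P : Measure (USphere p)) : HarmIndex p k → ℝ :=
  fun r => ∫ u, harmVec p k u r ∂P

/-- The covariance matrix `Var[G_{p,k}(U)]` for `U` with law `P`. -/
def covMat (p k : ℕ) (P : Measure (USphere p)) : Matrix (HarmIndex p k) (HarmIndex p k) ℝ :=
  Matrix.of fun r s => covariance (fun u => harmVec p k u r) (fun u => harmVec p k u s) P

/-- The cross-moment matrix `E[G_{p,k}(U) (G_{p,l}(U))']` for `U` with law `P`. -/
def crossMat (p k l : ℕ) (P : Measure (USphere p)) : Matrix (HarmIndex p k) (HarmIndex p l) ℝ :=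
  Matrix.of fun r s => ∫ u, harmVec p k u r * harmVec p l u s ∂P

end SphereMoments

end

noncomputable section

namespace SphereMoments

open scoped ENNReal Pointwise

/-! ### Pochhammer symbols -/

/-! Under the surface measure the hyperspherical angles are independent up to normalization: the `(i
+ 1)`-st has density `sin ^ i` on its range (`map_angles`). A basis function is a product of
functions of single angles, so every integral of basis functions becomes a product of
one-dimensional integrals (`integral_prod_angles`).

Orthonormality for the uniform law follows. If two multi-indices differ, take the last position
where they do. Their later entries agree, hence so do the powers of the sine and the Gegenbauer
parameter attached to that position, and the corresponding factor is an inner product of two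
Gegenbauer polynomials of one family and different degrees (or of two distinct trigonometric
functions), which vanishes (`factorInner_eq_zero`). If the indices agree, `B_m` is the product of
the constants that give each factor the norm of the constant function `1`
(`normFactor_mul_factorInner`). Gegenbauer orthogonality itself comes from integration by parts,
which lowers both degrees by one and raises the parameter by one (`gegInner_succ_succ`).

The mean formula is exact, not asymptotic. The density depends on the last angle only. An index
other than `(k, 0, …, 0)` has a last nonzero entry beyond the first; for `p ≥ 3` its factor lives on
another angle and integrates to zero, and for `p = 2` a reflection does the job
(`integral_harmBasis_mul_comp_cos`). The remaining component is zonal (`harmBasis_single`).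

For the limits, `f (κ_n u'θ_0)` tends to `1` and is eventually bounded uniformly in `u`, while basis
functions are bounded; dominated convergence sends every moment to its value under the uniform law
(`tendsto_integral_harmBasis_mul`). Means vanish in the limit because degree `0` is the constant
`1`. -/

@[simp] theorem poch_zero (a : ℝ) : poch a 0 = 1 := by simp [poch]

theorem poch_succ (a : ℝ) (k : ℕ) : poch a (k + 1) = poch a k * (a + k) := by
  simp [poch, ascPochhammer_succ_eval]

theorem poch_succ_left (a : ℝ) (k : ℕ) : poch a (k + 1) = a * poch (a + 1) k := by
  simp [poch, ascPochhammer_succ_left, Polynomial.eval_comp]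

theorem poch_pos {a : ℝ} (ha : 0 < a) (k : ℕ) : 0 < poch a k := ascPochhammer_pos k a ha

theorem Gamma_natCast_add {a : ℝ} (ha : 0 < a) (k : ℕ) :
    Real.Gamma (k + a) = poch a k * Real.Gamma a := by
  induction k with
  | zero => simp
  | succ k ih =>
    rw [poch_succ, show ((k + 1 : ℕ) : ℝ) + a = (k + a) + 1 by push_cast; ring,
      Real.Gamma_add_one (by positivity), ih]
    ring

/-! ### Gegenbauer polynomials -/

/-- The coefficient of `t ^ i` in the Gegenbauer polynomial of degree `i + 2 j`. -/
def gegCoef (lam : ℝ) (i j : ℕ) : ℝ :=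
  (-1) ^ j * (2 ^ i * poch lam (i + j) / (j.factorial * i.factorial))

/-- The Gegenbauer polynomial as a polynomial. -/
def gegPoly (lam : ℝ) (q : ℕ) : Polynomial ℝ :=
  ∑ j ∈ Finset.range (q / 2 + 1), Polynomial.monomial (q - 2 * j) (gegCoef lam (q - 2 * j) j)

theorem gegenbauer_eq_eval {lam : ℝ} (h : 0 < lam) (q : ℕ) (t : ℝ) :
    gegenbauer lam q t = (gegPoly lam q).eval t := by
  rw [gegenbauer, if_neg h.ne', gegPoly, Polynomial.eval_finsetSum]
  refine Finset.sum_congr rfl fun j hj => ?_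
  have hj' : 2 * j ≤ q := by have := Finset.mem_range.1 hj; omega
  have hG := (Real.Gamma_pos_of_pos h).ne'
  rw [Polynomial.eval_monomial, gegCoef, Gamma_natCast_add h,
    show q - 2 * j + j = q - j by omega]
  field_simp

theorem coeff_gegPoly_add (lam : ℝ) (i j : ℕ) :
    (gegPoly lam (i + 2 * j)).coeff i = gegCoef lam i j := by
  rw [gegPoly, Polynomial.finsetSum_coeff, Finset.sum_eq_single j]
  · simp
  · intro b hb hbj
    have := Finset.mem_range.1 hb
    rw [Polynomial.coeff_monomial, if_neg (by omega)]
  · intro hj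
    exact absurd (Finset.mem_range.2 (by omega)) hj

theorem coeff_gegPoly_eq_zero (lam : ℝ) {q i : ℕ} (h : ∀ j, i + 2 * j ≠ q) :
    (gegPoly lam q).coeff i = 0 := by
  rw [gegPoly, Polynomial.finsetSum_coeff]
  refine Finset.sum_eq_zero fun b hb => ?_
  have := Finset.mem_range.1 hb
  have := h b
  rw [Polynomial.coeff_monomial, if_neg (by omega)]

@[simp] theorem gegPoly_zero (lam : ℝ) : gegPoly lam 0 = 1 := by
  simp [gegPoly, gegCoef]

theorem derivative_gegPoly (lam : ℝ) (q : ℕ) :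
    (gegPoly lam (q + 1)).derivative = Polynomial.C (2 * lam) * gegPoly (lam + 1) q := by
  ext i
  rw [Polynomial.coeff_derivative, Polynomial.coeff_C_mul]
  by_cases h : ∃ j, i + 2 * j = q
  · obtain ⟨j, rfl⟩ := h
    rw [show i + 2 * j + 1 = (i + 1) + 2 * j by ring, coeff_gegPoly_add, coeff_gegPoly_add,
      gegCoef, gegCoef, show i + 1 + j = i + j + 1 by ring, poch_succ_left, Nat.factorial_succ]
    push_cast
    field_simp
    ring
  · push Not at h
    rw [coeff_gegPoly_eq_zero _ h, coeff_gegPoly_eq_zero _ fun j hj => h j (by omega)]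
    simp

/-- The Rodrigues step, adjoint to `derivative_gegPoly`: up to a constant, `-d/dt [(1 - t²)^(λ +
1/2) C_q^(λ+1)]` is `(1 - t²)^(λ - 1/2) C_(q+1)^λ`. Dividing out the weight leaves a polynomial
identity, checked coefficient by coefficient. -/
theorem gegPoly_adjoint {lam : ℝ} (h : 0 < lam) (q : ℕ) :
    Polynomial.C (2 * lam + 1) * (Polynomial.X * gegPoly (lam + 1) q)
        - (gegPoly (lam + 1) q).derivative
        + Polynomial.X * (Polynomial.X * (gegPoly (lam + 1) q).derivative) =
      Polynomial.C ((q + 1) * (q + 1 + 2 * lam) / (2 * lam)) * gegPoly lam (q + 1) := by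
  ext i
  rw [Polynomial.coeff_add, Polynomial.coeff_sub, Polynomial.coeff_C_mul, Polynomial.coeff_C_mul,
    Polynomial.coeff_derivative]
  by_cases hj : ∃ j, i + 2 * j = q + 1
  · obtain ⟨j, hj⟩ := hj
    have hq : (q : ℝ) + 1 = i + 2 * j := by exact_mod_cast hj.symm
    rw [hq, ← hj, coeff_gegPoly_add]
    -- All three contributions are expressed through the single coefficient `gegCoef lam i j`. For
    -- `j = 0` the index `i + 1` exceeds the degree `q`, and both sides are zero.
    have h1 : (gegPoly (lam + 1) q).coeff (i + 1) * ((i : ℝ) + 1) =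
        - (gegCoef lam i j * (2 * j * (lam + i + j) / lam)) := by
      rcases j with _ | j
      · rw [coeff_gegPoly_eq_zero _ fun j hj => by omega]
        simp
      · obtain rfl : q = (i + 1) + 2 * j := by omega
        rw [coeff_gegPoly_add, gegCoef, gegCoef, show i + (j + 1) = (i + j) + 1 by ring,
          poch_succ_left, show i + 1 + j = i + j + 1 by ring, poch_succ, Nat.factorial_succ,
          Nat.factorial_succ]
        push_cast
        field_simp
        ring
    rw [h1]
    rcases i with _ | i
    · simp
      field_simp
      ring
    · obtain rfl : q = i + 2 * j := by omega
      have h2 : (gegPoly (lam + 1) (i + 2 * j)).coeff i =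
          gegCoef lam (i + 1) j * ((i + 1) / (2 * lam)) := by
        rw [coeff_gegPoly_add, gegCoef, gegCoef, show i + 1 + j = i + j + 1 by ring,
          poch_succ_left, Nat.factorial_succ]
        push_cast
        field_simp
        ring
      have h3 : (Polynomial.X * (gegPoly (lam + 1) (i + 2 * j)).derivative).coeff i =
          i * (gegPoly (lam + 1) (i + 2 * j)).coeff i := by
        rcases i with _ | i
        · simp
        · rw [Polynomial.coeff_X_mul, Polynomial.coeff_derivative]
          push_cast
          ring
      rw [Polynomial.coeff_X_mul, Polynomial.coeff_X_mul, h3, h2]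
      push_cast
      field_simp
      ring
  · push Not at hj
    rw [coeff_gegPoly_eq_zero _ hj, coeff_gegPoly_eq_zero _ fun j h => hj (j + 1) (by omega)]
    rcases i with _ | i
    · simp
    · have h0 := coeff_gegPoly_eq_zero (lam + 1) (q := q) (i := i) fun j h => hj j (by omega)
      rw [Polynomial.coeff_X_mul, Polynomial.coeff_X_mul, h0]
      rcases i with _ | i
      · simp
      · rw [Polynomial.coeff_X_mul, Polynomial.coeff_derivative, h0]
        simp

/-! ### Orthogonality of Gegenbauer polynomials -/

/-- The inner product of two Gegenbauer polynomials of parameter `N / 2`, in the angle. -/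
def gegInner (N q r : ℕ) : ℝ :=
  ∫ t in (0 : ℝ)..Real.pi, gegenbauer (N / 2) q (Real.cos t) * gegenbauer (N / 2) r (Real.cos t) *
    Real.sin t ^ N

theorem gegInner_comm (N q r : ℕ) : gegInner N q r = gegInner N r q := by
  simp only [gegInner, mul_comm (gegenbauer (N / 2) q _)]

theorem gegenbauer_zero_right {lam : ℝ} (h : 0 < lam) (t : ℝ) : gegenbauer lam 0 t = 1 := by
  simp [gegenbauer_eq_eval h]

/-- Integration by parts based on `gegPoly_adjoint` with `λ = N / 2`; the boundary terms carry `sin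
^ (N + 1)` and vanish at `0` and `π`. -/
theorem integral_eval_gegenbauer {N : ℕ} (hN : 0 < N) (q : ℕ) (P : Polynomial ℝ) :
    ∫ t in (0 : ℝ)..Real.pi, P.eval (Real.cos t) * gegenbauer (N / 2) (q + 1) (Real.cos t) *
        Real.sin t ^ N =
      N / ((q + 1) * (q + 1 + N)) * ∫ t in (0 : ℝ)..Real.pi, P.derivative.eval (Real.cos t) *
        gegenbauer ((N + 2 : ℕ) / 2) q (Real.cos t) * Real.sin t ^ (N + 2) := by
  have hl : (0 : ℝ) < N / 2 := by positivity
  have hN' : (0 : ℝ) < N := by positivity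
  set G := gegPoly ((N : ℝ) / 2 + 1) q with hG
  have e1 : ∀ t, gegenbauer ((N + 2 : ℕ) / 2) q t = G.eval t := fun t => by
    rw [show (((N + 2 : ℕ) : ℝ) / 2) = N / 2 + 1 by push_cast; ring,
      gegenbauer_eq_eval (by positivity)]
  have e2 : ∀ t, gegenbauer (N / 2) (q + 1) t = N / ((q + 1) * (q + 1 + N)) *
      ((N + 1) * (t * G.eval t) - (1 - t ^ 2) * G.derivative.eval t) := fun t => by
    have := congrArg (Polynomial.eval t) (gegPoly_adjoint hl q)
    rw [← hG] at this
    simp only [Polynomial.eval_add, Polynomial.eval_sub, Polynomial.eval_mul, Polynomial.eval_C,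
      Polynomial.eval_X] at this
    rw [← gegenbauer_eq_eval hl] at this
    rw [show 2 * ((N : ℝ) / 2) = N by ring] at this
    have h2 : gegenbauer (N / 2) (q + 1) t = N / ((q + 1) * (q + 1 + N)) *
      ((q + 1) * (q + 1 + N) / N * gegenbauer (N / 2) (q + 1) t) := by field_simp
    rw [h2, ← this]
    ring
  simp only [e1, e2]
  have hd : ∀ t ∈ Set.uIcc 0 Real.pi,
      HasDerivAt (fun t => P.eval (Real.cos t) * (Real.sin t ^ (N + 1) * G.eval (Real.cos t)))
        (P.eval (Real.cos t) * ((N + 1) * (Real.cos t * G.eval (Real.cos t)) -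
            (1 - Real.cos t ^ 2) * G.derivative.eval (Real.cos t)) * Real.sin t ^ N -
          P.derivative.eval (Real.cos t) * G.eval (Real.cos t) * Real.sin t ^ (N + 2)) t := by
    intro t _
    have hc := Real.hasDerivAt_cos t
    have h1 := (P.hasDerivAt (Real.cos t)).comp t hc
    have h2 := (G.hasDerivAt (Real.cos t)).comp t hc
    have h3 := (Real.hasDerivAt_sin t).pow (N + 1)
    refine (h1.mul (h3.mul h2)).congr_deriv ?_
    have : 1 - Real.cos t ^ 2 = Real.sin t ^ 2 := by rw [Real.sin_sq]
    simp only [Function.comp_apply, this, Pi.pow_apply, Pi.mul_apply]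
    push_cast
    ring
  have := intervalIntegral.integral_eq_sub_of_hasDerivAt hd
    (Continuous.intervalIntegrable (by fun_prop) _ _)
  simp only [Real.sin_pi, Real.sin_zero] at this
  rw [intervalIntegral.integral_sub (Continuous.intervalIntegrable (by fun_prop) _ _)
    (Continuous.intervalIntegrable (by fun_prop) _ _)] at this
  rw [← intervalIntegral.integral_const_mul]
  simp only [ne_eq, Nat.add_eq_zero_iff, one_ne_zero, and_false, not_false_eq_true, zero_pow,
    zero_mul, mul_zero, sub_zero] at this
  rw [sub_eq_zero] at this
  rw [intervalIntegral.integral_const_mul, ← this, ← intervalIntegral.integral_const_mul]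
  congr 1
  ext t
  ring

/-- The derivative of a Gegenbauer polynomial again has parameter one higher, so the integration by
parts closes up into a recursion. Both orthogonality and the norms follow by induction on the
degree, with `N` varying. -/
theorem gegInner_succ_succ {N : ℕ} (hN : 0 < N) (q r : ℕ) :
    gegInner N (q + 1) (r + 1) =
      N ^ 2 / ((q + 1) * (q + 1 + N)) * gegInner (N + 2) q r := by
  have hl : (0 : ℝ) < N / 2 := by positivity
  have := integral_eval_gegenbauer hN q (gegPoly (N / 2) (r + 1))
  rw [gegInner_comm, gegInner, gegInner]
  simp only [gegenbauer_eq_eval hl (r + 1)]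
  rw [this, derivative_gegPoly, ← intervalIntegral.integral_const_mul,
    ← intervalIntegral.integral_const_mul]
  congr 1
  ext t
  rw [Polynomial.eval_mul, Polynomial.eval_C,
    show ((N : ℝ) / 2 + 1) = ((N + 2 : ℕ) : ℝ) / 2 by push_cast; ring,
    ← gegenbauer_eq_eval (by positivity)]
  ring

theorem gegInner_succ_zero {N : ℕ} (hN : 0 < N) (q : ℕ) : gegInner N (q + 1) 0 = 0 := by
  have hl : (0 : ℝ) < N / 2 := by positivity
  have := integral_eval_gegenbauer hN q 1
  rw [gegInner_comm, gegInner]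
  simpa [gegenbauer_zero_right hl] using this

theorem gegInner_of_ne {N : ℕ} (hN : 0 < N) {q r : ℕ} (h : q ≠ r) : gegInner N q r = 0 := by
  induction q generalizing N r with
  | zero =>
    obtain ⟨r, rfl⟩ := Nat.exists_eq_succ_of_ne_zero h.symm
    rw [gegInner_comm, gegInner_succ_zero hN]
  | succ q ih =>
    rcases r with _ | r
    · exact gegInner_succ_zero hN q
    · rw [gegInner_succ_succ hN, ih (by omega) (by omega), mul_zero]

theorem gegInner_self {N : ℕ} (hN : 0 < N) (q : ℕ) :
    gegInner N q q = poch N q * (N / 2) / (q.factorial * (q + N / 2)) *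
      ∫ t in (0 : ℝ)..Real.pi, Real.sin t ^ N := by
  induction q generalizing N with
  | zero =>
    have hl : (0 : ℝ) < N / 2 := by positivity
    simp only [gegInner, gegenbauer_zero_right hl]
    simp [hl.ne']
  | succ q ih =>
    have hN' : (0 : ℝ) < N := by positivity
    rw [gegInner_succ_succ hN, ih (by omega), integral_sin_pow]
    have h2 : poch N (q + 1) * (N + (q + 1)) = N * ((N + 1) * poch (N + 2) q) := by
      have := poch_succ N (q + 1)
      rw [poch_succ_left, poch_succ_left] at this
      push_cast at this
      rw [← this]
      ring_nf
    have h1 : poch N (q + 1) = N * ((N + 1) * poch (N + 2) q) / (N + (q + 1)) := by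
      rw [← h2]; field_simp
    rw [h1, Nat.factorial_succ]
    simp only [Real.sin_pi, Real.sin_zero]
    push_cast
    simp only [ne_eq, Nat.add_eq_zero_iff, one_ne_zero, and_false, not_false_eq_true, zero_pow,
      zero_mul, sub_zero, zero_div, zero_add]
    have : (N : ℝ) + 2 ≠ 0 := by positivity
    have : (q : ℝ) + (N + 2) / 2 ≠ 0 := by positivity
    field_simp
    ring

/-- Iterates the reduction formula for powers of the sine. It accounts for the quotient of
Pochhammer symbols in `B_m` that depends only on the tail sum. -/
theorem integral_sin_pow_add_two_mul (M s : ℕ) :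
    ∫ t in (0 : ℝ)..Real.pi, Real.sin t ^ (M + 2 * s) =
      poch (((M : ℝ) + 1) / 2) s / poch (((M : ℝ) + 2) / 2) s *
        ∫ t in (0 : ℝ)..Real.pi, Real.sin t ^ M := by
  induction s with
  | zero => simp
  | succ s ih =>
    rw [show M + 2 * (s + 1) = (M + 2 * s) + 2 by ring, integral_sin_pow, ih, poch_succ, poch_succ]
    have := poch_pos (show (0 : ℝ) < ((M : ℝ) + 2) / 2 by positivity) s
    simp only [Real.sin_pi, Real.sin_zero]
    push_cast
    simp only [ne_eq, Nat.add_eq_zero_iff, one_ne_zero, and_false, not_false_eq_true, zero_pow,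
      zero_mul, sub_zero, zero_div, zero_add]
    field_simp
    ring

/-! ### Joint law of the hyperspherical angles -/

theorem measurable_ent {p : ℕ} (i : ℕ) :
    Measurable fun x : EuclideanSpace ℝ (Fin p) => ent (fun a => x a) i := by
  unfold ent
  split <;> fun_prop

theorem measurable_partialRadius {p : ℕ} (i : ℕ) :
    Measurable fun x : EuclideanSpace ℝ (Fin p) => partialRadius x i := by
  unfold partialRadius
  exact (Finset.measurable_sum _ fun l _ => (measurable_ent l).pow_const 2).sqrt

theorem measurable_toIcoMod : Measurable (toIcoMod Real.two_pi_pos (0 : ℝ)) := by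
  have : toIcoMod Real.two_pi_pos (0 : ℝ) = fun x => Int.fract (x / (2 * Real.pi)) * (2 * Real.pi) := by
    ext x
    rw [toIcoMod_eq_fract_mul]
  rw [this]
  fun_prop

theorem measurable_angle {p : ℕ} (j : ℕ) :
    Measurable fun x : EuclideanSpace ℝ (Fin p) => angle x j := by
  unfold angle
  split
  · have h : Measurable fun x : EuclideanSpace ℝ (Fin p) =>
        (⟨ent (fun a => x a) 2, ent (fun a => x a) 1⟩ : ℂ) := by
      have : (fun x : EuclideanSpace ℝ (Fin p) =>
          (⟨ent (fun a => x a) 2, ent (fun a => x a) 1⟩ : ℂ)) = fun x =>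
          ((ent (fun a => x a) 2 : ℝ) : ℂ) + ((ent (fun a => x a) 1 : ℝ) : ℂ) * Complex.I := by
        ext x
        exact Complex.mk_eq_add_mul_I _ _
      rw [this]
      exact (Complex.measurable_ofReal.comp (measurable_ent 2)).add
        ((Complex.measurable_ofReal.comp (measurable_ent 1)).mul_const _)
    exact measurable_toIcoMod.comp (Complex.measurable_arg.comp h)
  · exact Real.measurable_arccos.comp ((measurable_ent _).div (measurable_partialRadius _))

/-- The upper end of the range of the `(i + 1)`-st hyperspherical angle. -/
def angleTop (i : ℕ) : ℝ := if i = 0 then 2 * Real.pi else Real.pi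

theorem angleTop_pos (i : ℕ) : 0 < angleTop i := by
  unfold angleTop
  split <;> positivity

/-- The law of the `(i + 1)`-st hyperspherical angle under the surface measure, up to a factor. -/
def angleLaw (i : ℕ) : Measure ℝ :=
  (volume.restrict (Set.Ioc 0 (angleTop i))).withDensity fun θ => ENNReal.ofReal (Real.sin θ ^ i)

theorem lintegral_angleLaw (i : ℕ) {h : ℝ → ℝ≥0∞} (hh : Measurable h) :
    ∫⁻ θ, h θ ∂angleLaw i =
      ∫⁻ θ in Set.Ioc 0 (angleTop i), ENNReal.ofReal (Real.sin θ ^ i) * h θ := by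
  rw [angleLaw, lintegral_withDensity_eq_lintegral_mul _ (by fun_prop) hh]
  rfl

theorem integral_angleLaw (i : ℕ) (h : ℝ → ℝ) :
    ∫ θ, h θ ∂angleLaw i = ∫ θ in (0 : ℝ)..angleTop i, h θ * Real.sin θ ^ i := by
  rw [angleLaw, integral_withDensity_eq_integral_toReal_smul (by fun_prop) (by simp),
    intervalIntegral.integral_of_le (angleTop_pos i).le]
  refine setIntegral_congr_fun measurableSet_Ioc fun θ hθ => ?_
  -- `ENNReal.ofReal` would truncate negative values of the sine. For `i = 0` the density is `1`;
  -- for `i > 0` the range is `(0, π]`, where the sine is nonnegative.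
  rcases i with _ | i
  · simp
  · have : 0 ≤ Real.sin θ := Real.sin_nonneg_of_nonneg_of_le_pi hθ.1.le (by simpa [angleTop] using hθ.2)
    simp only [smul_eq_mul]
    rw [ENNReal.toReal_ofReal (by positivity), mul_comm]

instance (i : ℕ) : IsFiniteMeasure (angleLaw i) := by
  refine isFiniteMeasure_withDensity_ofReal (HasFiniteIntegral.of_bounded (C := 1) ?_)
  refine Eventually.of_forall fun θ => ?_
  rw [norm_pow]
  exact pow_le_one₀ (norm_nonneg _) (Real.abs_sin_le_one θ)

/-- Both intervals are, up to endpoints, fundamental domains for translation by `2π`. This converts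
the range of the argument in polar coordinates to that of `θ_1`. -/
theorem lintegral_toIcoMod {h : ℝ → ℝ≥0∞} :
    ∫⁻ θ in Set.Ioo (-Real.pi) Real.pi, h (toIcoMod Real.two_pi_pos 0 θ) =
      ∫⁻ θ in Set.Ioc 0 (2 * Real.pi), h θ := by
  have : VAddInvariantMeasure (AddSubgroup.zmultiples (2 * Real.pi)) ℝ volume :=
    ⟨fun c s _ => measure_preimage_add _ _ _⟩
  have h1 := (isAddFundamentalDomain_Ioc Real.two_pi_pos (-Real.pi)).setLIntegral_eq
    (isAddFundamentalDomain_Ioc Real.two_pi_pos 0) (fun θ => h (toIcoMod Real.two_pi_pos 0 θ))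
    (by
      rintro ⟨g, hg⟩ x
      obtain ⟨m, rfl⟩ := AddSubgroup.mem_zmultiples_iff.1 hg
      simp only [AddSubgroup.mk_vadd, vadd_eq_add, toIcoMod_zsmul_add])
  rw [show -Real.pi + 2 * Real.pi = Real.pi by ring, zero_add] at h1
  rw [restrict_Ioo_eq_restrict_Ioc, h1, ← restrict_Ioo_eq_restrict_Ioc]
  refine setLIntegral_congr_fun measurableSet_Ioo fun θ hθ => ?_
  rw [(toIcoMod_eq_self Real.two_pi_pos).2]
  simpa using ⟨hθ.1.le, hθ.2⟩

/-- Polar coordinates on the half-plane `r > 0`, with the angle measured from the `y`-axis: the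
polar change of variables in the whole plane applied to an integrand cut off by an indicator. -/
theorem lintegral_half_plane {F : ℝ → ℝ → ℝ≥0∞} (hF : Measurable (Function.uncurry F)) :
    ∫⁻ y, ∫⁻ r in Set.Ioi 0, F y r =
      ∫⁻ R in Set.Ioi 0, ∫⁻ θ in Set.Ioc 0 Real.pi,
        ENNReal.ofReal R * F (R * Real.cos θ) (R * Real.sin θ) := by
  have hS : MeasurableSet {q : ℝ × ℝ | 0 < q.2} := measurableSet_lt measurable_const measurable_snd
  have h1 : ∫⁻ y, ∫⁻ r in Set.Ioi 0, F y r =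
      ∫⁻ q : ℝ × ℝ, {q : ℝ × ℝ | 0 < q.2}.indicator (Function.uncurry F) q := by
    rw [Measure.volume_eq_prod, lintegral_prod _ (hF.indicator hS).aemeasurable]
    refine lintegral_congr fun y => ?_
    rw [← lintegral_indicator measurableSet_Ioi]
    rfl
  have hm : Measurable fun q : ℝ × ℝ => ENNReal.ofReal q.1 *
      F (q.1 * Real.cos q.2) (q.1 * Real.sin q.2) :=
    (ENNReal.measurable_ofReal.comp measurable_fst).mul (hF.comp ((measurable_fst.mul (Real.measurable_cos.comp measurable_snd)).prodMk
      (measurable_fst.mul (Real.measurable_sin.comp measurable_snd))))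
  rw [h1, ← lintegral_comp_polarCoord_symm]
  simp_rw [restrict_Ioo_eq_restrict_Ioc.symm]
  rw [← lintegral_prod (fun q : ℝ × ℝ => ENNReal.ofReal q.1 *
      F (q.1 * Real.cos q.2) (q.1 * Real.sin q.2)) hm.aemeasurable, Measure.prod_restrict,
    ← Measure.volume_eq_prod, polarCoord_target,
    ← lintegral_indicator (measurableSet_Ioi.prod measurableSet_Ioo),
    ← lintegral_indicator (measurableSet_Ioi.prod measurableSet_Ioo)]
  refine lintegral_congr fun q => ?_
  obtain ⟨R, θ⟩ := q
  simp only [Set.indicator, Set.mem_prod, Set.mem_Ioi, Set.mem_Ioo, Set.mem_ofPred_eq,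
    polarCoord_symm_apply, smul_eq_mul, Function.uncurry]
  by_cases hR : 0 < R
  · by_cases h0 : 0 < θ
    · by_cases hp : θ < Real.pi
      · have := Real.sin_pos_of_pos_of_lt_pi h0 hp
        have a1 : 0 < R * Real.sin θ := by positivity
        have a2 : 0 < R ∧ -Real.pi < θ ∧ θ < Real.pi := ⟨hR, by linarith, hp⟩
        have a3 : 0 < R ∧ 0 < θ ∧ θ < Real.pi := ⟨hR, h0, hp⟩
        rw [if_pos a1, if_pos a2, if_pos a3]
      · simp [hp]
    · rw [if_neg (by tauto : ¬(0 < R ∧ 0 < θ ∧ θ < Real.pi))]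
      split_ifs with h2 h3
      · have := Real.sin_nonpos_of_nonpos_of_neg_pi_le (not_lt.1 h0) h2.2.1.le
        nlinarith
      · simp
      · rfl
  · simp [hR]

theorem ent_snoc {n : ℕ} (x : Fin n → ℝ) (y : ℝ) {l : ℕ} (hl : l ≤ n) :
    ent (Fin.snoc x y : Fin (n + 1) → ℝ) l = ent x l := by
  unfold ent
  by_cases h : 1 ≤ l
  · rw [dif_pos ⟨h, by omega⟩, dif_pos ⟨h, hl⟩]
    exact Fin.snoc_castSucc (α := fun _ => ℝ) y x ⟨l - 1, by omega⟩
  · rw [dif_neg (by tauto), dif_neg (by tauto)]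

theorem ent_snoc_last {n : ℕ} (x : Fin n → ℝ) (y : ℝ) :
    ent (Fin.snoc x y : Fin (n + 1) → ℝ) (n + 1) = y := by
  rw [ent, dif_pos ⟨by omega, le_rfl⟩]
  exact Fin.snoc_last (α := fun _ => ℝ) y x

theorem partialRadius_snoc {n : ℕ} (x : Fin n → ℝ) (y : ℝ) {l : ℕ} (hl : l ≤ n) :
    partialRadius (WithLp.toLp 2 (Fin.snoc x y : Fin (n + 1) → ℝ)) l =
      partialRadius (WithLp.toLp 2 x) l := by
  unfold partialRadius
  congr 1
  refine Finset.sum_congr rfl fun i hi => ?_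
  rw [ent_snoc x y ((Finset.mem_Icc.1 hi).2.trans hl)]

theorem angle_snoc {n : ℕ} (hn : 2 ≤ n) (x : Fin n → ℝ) (y : ℝ) {l : ℕ} (hl : l + 1 ≤ n) :
    angle (WithLp.toLp 2 (Fin.snoc x y : Fin (n + 1) → ℝ)) l = angle (WithLp.toLp 2 x) l := by
  unfold angle
  rw [partialRadius_snoc x y hl, ent_snoc x y hl, ent_snoc x y hn, ent_snoc x y (by omega)]

theorem lintegral_radius_angles_two {ρ h : ℝ → ℝ≥0∞} (hρ : Measurable ρ) (hh : Measurable h) :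
    ∫⁻ x : Fin 2 → ℝ, ρ (partialRadius (WithLp.toLp 2 x) 2) * h (angle (WithLp.toLp 2 x) 1) =
      (∫⁻ r in Set.Ioi 0, ρ r * ENNReal.ofReal (r ^ 1)) * ∫⁻ θ, h θ ∂angleLaw 0 := by
  -- The swap reflects the convention `x_1 = r sin θ_1`, `x_2 = r cos θ_1`.
  have hmp : MeasurePreserving (fun q : ℝ × ℝ => ![q.2, q.1]) :=
    ((volume_preserving_finTwoArrow ℝ).symm).comp Measure.measurePreserving_swap
  have hm : Measurable fun x : Fin 2 → ℝ =>
      ρ (partialRadius (WithLp.toLp 2 x) 2) * h (angle (WithLp.toLp 2 x) 1) :=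
    (hρ.comp ((measurable_partialRadius 2).comp (WithLp.measurable_toLp 2 _))).mul
      (hh.comp ((measurable_angle 1).comp (WithLp.measurable_toLp 2 _)))
  rw [← hmp.lintegral_comp hm, ← lintegral_comp_polarCoord_symm, lintegral_angleLaw 0 hh]
  simp only [pow_zero, ENNReal.ofReal_one, one_mul, pow_one, angleTop, if_true]
  rw [← lintegral_toIcoMod, ← lintegral_prod_mul (f := fun r => ρ r * ENNReal.ofReal r)
    (g := fun θ => h (toIcoMod Real.two_pi_pos 0 θ)) (by fun_prop)
    (hh.comp measurable_toIcoMod).aemeasurable, Measure.prod_restrict,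
    ← Measure.volume_eq_prod, polarCoord_target]
  refine setLIntegral_congr_fun (measurableSet_Ioi.prod measurableSet_Ioo) fun q hq => ?_
  obtain ⟨R, θ⟩ := q
  obtain ⟨hR, hθ⟩ := hq
  simp only [Set.mem_Ioi, Set.mem_Ioo] at hR hθ
  have h1 : partialRadius (WithLp.toLp 2 ![R * Real.sin θ, R * Real.cos θ]) 2 = R := by
    rw [partialRadius, Finset.sum_Icc_succ_top (by omega)]
    simp only [Finset.Icc_self, Finset.sum_singleton]
    rw [show ent (fun a => (WithLp.toLp 2 ![R * Real.sin θ, R * Real.cos θ]) a) 1 =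
        R * Real.sin θ by simp [ent],
      show ent (fun a => (WithLp.toLp 2 ![R * Real.sin θ, R * Real.cos θ]) a) (1 + 1) =
        R * Real.cos θ by simp [ent],
      show (R * Real.sin θ) ^ 2 + (R * Real.cos θ) ^ 2 = R ^ 2 * (Real.sin θ ^ 2 + Real.cos θ ^ 2) by
        ring, Real.sin_sq_add_cos_sq, mul_one, Real.sqrt_sq hR.le]
  have h2 : angle (WithLp.toLp 2 ![R * Real.sin θ, R * Real.cos θ]) 1 =
      toIcoMod Real.two_pi_pos 0 θ := by
    have : (⟨R * Real.cos θ, R * Real.sin θ⟩ : ℂ) =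
        R * (Complex.cos θ + Complex.sin θ * Complex.I) := by
      rw [Complex.mk_eq_add_mul_I]
      push_cast
      ring
    rw [angle, if_pos rfl,
      show ent (fun a => (WithLp.toLp 2 ![R * Real.sin θ, R * Real.cos θ]) a) 1 =
        R * Real.sin θ by simp [ent],
      show ent (fun a => (WithLp.toLp 2 ![R * Real.sin θ, R * Real.cos θ]) a) 2 =
        R * Real.cos θ by simp [ent], this, Complex.arg_mul_cos_add_sin_mul_I hR ⟨hθ.1, hθ.2.le⟩]
  simp only [polarCoord_symm_apply, smul_eq_mul, h1, h2]
  ring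

/-- Induction on the dimension by splitting off the last coordinate `y`. Earlier angles do not see
`y`, and the new radius and angle are the polar coordinates of `(y, r)`, with `r` the old radius.
The factor `r ^ (n + 1) = (R sin θ) ^ (n + 1)`, together with the Jacobian `R`, gives the new radial
power and the density of the new angle. An arbitrary radial weight `ρ` is what lets the induction
run. -/
theorem lintegral_radius_angles (n : ℕ) {ρ : ℝ → ℝ≥0∞} (hρ : Measurable ρ) {h : ℕ → ℝ → ℝ≥0∞}
    (hh : ∀ i, Measurable (h i)) :
    ∫⁻ x : Fin (n + 2) → ℝ, ρ (partialRadius (WithLp.toLp 2 x) (n + 2)) *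
        ∏ i ∈ Finset.range (n + 1), h i (angle (WithLp.toLp 2 x) (i + 1)) =
      (∫⁻ r in Set.Ioi 0, ρ r * ENNReal.ofReal (r ^ (n + 1))) *
        ∏ i ∈ Finset.range (n + 1), ∫⁻ θ, h i θ ∂angleLaw i := by
  induction n generalizing ρ with
  | zero => simpa using lintegral_radius_angles_two hρ (hh 0)
  | succ n ih =>
    have hmp : MeasurePreserving (fun q : ℝ × (Fin (n + 2) → ℝ) =>
        (Fin.snoc q.2 q.1 : Fin (n + 3) → ℝ)) := by
      have := (volume_preserving_piFinSuccAbove (fun _ : Fin (n + 3) => ℝ) (Fin.last _)).symm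
      convert this using 2 with q
      simp [MeasurableEquiv.piFinSuccAbove]
      rfl
    have hm : Measurable fun x : Fin (n + 3) → ℝ =>
        ρ (partialRadius (WithLp.toLp 2 x) (n + 3)) *
        ∏ i ∈ Finset.range (n + 2), h i (angle (WithLp.toLp 2 x) (i + 1)) :=
      (hρ.comp ((measurable_partialRadius _).comp (WithLp.measurable_toLp 2 _))).mul
        (Finset.measurable_prod _ fun i _ =>
          (hh i).comp ((measurable_angle _).comp (WithLp.measurable_toLp 2 _)))
    set W := ∏ i ∈ Finset.range (n + 1), ∫⁻ θ, h i θ ∂angleLaw i with hW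
    -- For fixed `y`, everything that involves the new radius or the new angle depends on the old
    -- radius `r` alone, so it serves as the radial weight in the induction hypothesis.
    let F : ℝ → ℝ → ℝ≥0∞ := fun y r =>
      ρ √(r ^ 2 + y ^ 2) * h (n + 1) (Real.arccos (y / √(r ^ 2 + y ^ 2)))
    have hF : Measurable (Function.uncurry F) := by
      refine (hρ.comp ?_).mul ((hh (n + 1)).comp (Real.measurable_arccos.comp ?_)) <;> fun_prop
    have hm' : Measurable fun q : ℝ × (Fin (n + 2) → ℝ) =>
        ρ (partialRadius (WithLp.toLp 2 (Fin.snoc q.2 q.1 : Fin (n + 3) → ℝ)) (n + 3)) *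
        ∏ i ∈ Finset.range (n + 2),
          h i (angle (WithLp.toLp 2 (Fin.snoc q.2 q.1 : Fin (n + 3) → ℝ)) (i + 1)) :=
      hm.comp hmp.measurable
    rw [← hmp.lintegral_comp hm, Measure.volume_eq_prod, lintegral_prod _ hm'.aemeasurable]
    have key : ∀ y : ℝ, ∫⁻ x : Fin (n + 2) → ℝ,
        ρ (partialRadius (WithLp.toLp 2 (Fin.snoc x y : Fin (n + 3) → ℝ)) (n + 3)) *
        ∏ i ∈ Finset.range (n + 2),
          h i (angle (WithLp.toLp 2 (Fin.snoc x y : Fin (n + 3) → ℝ)) (i + 1)) =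
        (∫⁻ r in Set.Ioi 0, F y r * ENNReal.ofReal (r ^ (n + 1))) * W := by
      intro y
      rw [← ih (ρ := F y) (hF.comp (measurable_const.prodMk measurable_id))]
      refine lintegral_congr fun x => ?_
      have hr : partialRadius (WithLp.toLp 2 (Fin.snoc x y : Fin (n + 3) → ℝ)) (n + 3) =
          √(partialRadius (WithLp.toLp 2 x) (n + 2) ^ 2 + y ^ 2) := by
        rw [← partialRadius_snoc x y le_rfl, ← Real.sqrt_sq (partialRadius_nonneg _ (n + 3)),
          partialRadius_succ_sq]
        congr 3
        exact ent_snoc_last x y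
      have ha : angle (WithLp.toLp 2 (Fin.snoc x y : Fin (n + 3) → ℝ)) (n + 2) =
          Real.arccos (y / √(partialRadius (WithLp.toLp 2 x) (n + 2) ^ 2 + y ^ 2)) := by
        rw [angle, if_neg (by omega), hr]
        congr 2
        exact ent_snoc_last x y
      rw [Finset.prod_range_succ, hr, ha]
      have : ∀ i ∈ Finset.range (n + 1),
          h i (angle (WithLp.toLp 2 (Fin.snoc x y : Fin (n + 3) → ℝ)) (i + 1)) =
          h i (angle (WithLp.toLp 2 x) (i + 1)) := fun i hi => by
        rw [angle_snoc (by omega) x y (by have := Finset.mem_range.1 hi; omega)]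
      rw [Finset.prod_congr rfl this]
      simp only [F]
      ring
    simp only [key]
    have hF' : Measurable (Function.uncurry fun y r => F y r * ENNReal.ofReal (r ^ (n + 1))) :=
      hF.mul (by fun_prop)
    have hF'' : Measurable fun y => ∫⁻ r in Set.Ioi 0, F y r * ENNReal.ofReal (r ^ (n + 1)) :=
      hF'.lintegral_prod_right' (ν := volume.restrict (Set.Ioi 0))
    rw [lintegral_mul_const _ hF'', lintegral_half_plane hF', Finset.prod_range_succ, ← hW, mul_comm W, ← mul_assoc]
    congr 1
    rw [lintegral_angleLaw _ (hh _), ← lintegral_mul_const _ (by fun_prop)]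
    refine setLIntegral_congr_fun measurableSet_Ioi fun R hR => ?_
    have hR' : (0 : ℝ) < R := hR
    simp only [angleTop, Nat.add_eq_zero_iff, one_ne_zero, and_false, if_false]
    have hm1 : Measurable fun θ : ℝ => ENNReal.ofReal (Real.sin θ ^ (n + 1)) * h (n + 1) θ :=
      (by fun_prop : Measurable fun θ : ℝ => ENNReal.ofReal (Real.sin θ ^ (n + 1))).mul (hh (n + 1))
    rw [← lintegral_const_mul _ hm1]
    refine setLIntegral_congr_fun measurableSet_Ioc fun θ hθ => ?_
    have hs : 0 ≤ Real.sin θ := Real.sin_nonneg_of_nonneg_of_le_pi hθ.1.le hθ.2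
    have e1 : √((R * Real.sin θ) ^ 2 + (R * Real.cos θ) ^ 2) = R := by
      rw [show (R * Real.sin θ) ^ 2 + (R * Real.cos θ) ^ 2 =
        R ^ 2 * (Real.sin θ ^ 2 + Real.cos θ ^ 2) by ring, Real.sin_sq_add_cos_sq, mul_one,
        Real.sqrt_sq hR'.le]
    simp only [F, e1]
    rw [mul_div_cancel_left₀ _ hR'.ne', Real.arccos_cos hθ.1.le hθ.2, mul_pow,
      ENNReal.ofReal_mul (by positivity), pow_succ R (n + 1), ENNReal.ofReal_mul (by positivity)]
    ring

/-! ### Homogeneity, and the passage from Lebesgue measure to the sphere -/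

theorem partialRadius_smul {p : ℕ} {c : ℝ} (hc : 0 < c) (x : EuclideanSpace ℝ (Fin p)) (i : ℕ) :
    partialRadius (c • x) i = c * partialRadius x i := by
  have h : ∀ l, ent (fun a => (c • x) a) l = c * ent (fun a => x a) l := fun l => by
    unfold ent
    split <;> simp
  unfold partialRadius
  simp only [h, mul_pow]
  rw [← Finset.mul_sum, Real.sqrt_mul (by positivity), Real.sqrt_sq hc.le]

theorem angle_smul {p : ℕ} {c : ℝ} (hc : 0 < c) (x : EuclideanSpace ℝ (Fin p)) (j : ℕ) :
    angle (c • x) j = angle x j := by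
  have h : ∀ l, ent (fun a => (c • x) a) l = c * ent (fun a => x a) l := fun l => by
    unfold ent
    split <;> simp
  unfold angle
  rw [partialRadius_smul hc, h, h, h, mul_div_mul_left _ _ hc.ne']
  have : (⟨c * ent (fun a => x a) 2, c * ent (fun a => x a) 1⟩ : ℂ) =
      c * ⟨ent (fun a => x a) 2, ent (fun a => x a) 1⟩ := by
    apply Complex.ext <;> simp
  rw [this, Complex.arg_real_mul _ hc]

theorem norm_eq_partialRadius {n : ℕ} (x : EuclideanSpace ℝ (Fin n)) :
    ‖x‖ = partialRadius x n := by
  by_cases hx : x = 0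
  · subst hx
    have : ∀ l, ent (fun _ : Fin n => (0 : ℝ)) l = 0 := fun l => by
      unfold ent
      split <;> simp
    simp [partialRadius, this]
  · have h0 : 0 < ‖x‖ := norm_pos_iff.2 hx
    have := partialRadius_top ⟨‖x‖⁻¹ • x, by simp [norm_smul, h0.ne']⟩
    simp only at this
    rw [partialRadius_smul (by positivity)] at this
    field_simp at this
    exact this.symm

/-- The vector of all hyperspherical angles. -/
def angles (n : ℕ) (x : USphere (n + 2)) (i : Fin (n + 1)) : ℝ := angle x.1 (i + 1)

theorem measurable_angles (n : ℕ) : Measurable (angles n) :=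
  measurable_pi_lambda _ fun _ => (measurable_angle _).comp measurable_subtype_coe

/-- The surface measure of a set is the dimension times the volume of the cone over it. Angles are
constant on rays, so for a preimage of a box that volume is given by `lintegral_radius_angles` with
the indicator of `(0, 1)` as radial weight. -/
theorem map_angles (n : ℕ) :
    (surfaceMeasure (n + 2)).map (angles n) = Measure.pi fun i : Fin (n + 1) => angleLaw i := by
  refine (Measure.pi_eq fun s hs => ?_).symm
  have hS := MeasurableSet.univ_pi hs
  rw [Measure.map_apply (measurable_angles n) hS, surfaceMeasure,
    Measure.toSphere_apply' _ (measurable_angles n hS)]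
  let h : ℕ → ℝ → ℝ≥0∞ := fun i =>
    if hi : i < n + 1 then (s ⟨i, hi⟩).indicator 1 else 1
  have hh : ∀ i, Measurable (h i) := fun i => by
    simp only [h]
    split
    · exact measurable_one.indicator (hs _)
    · exact measurable_one
  have key := lintegral_radius_angles n (ρ := (Set.Ioo 0 1).indicator 1)
    (measurable_one.indicator measurableSet_Ioo) hh
  have hprod : ∏ i ∈ Finset.range (n + 1), ∫⁻ θ, h i θ ∂angleLaw i =
      ∏ i : Fin (n + 1), angleLaw i (s i) := by
    rw [← Fin.prod_univ_eq_prod_range (fun i => ∫⁻ θ, h i θ ∂angleLaw i)]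
    refine Finset.prod_congr rfl fun i _ => ?_
    simp only [h, i.2, dif_pos, Fin.eta]
    exact lintegral_indicator_one (hs i)
  have hrad : ∫⁻ r in Set.Ioi (0 : ℝ), (Set.Ioo (0 : ℝ) 1).indicator (1 : ℝ → ℝ≥0∞) r *
      ENNReal.ofReal (r ^ (n + 1)) = ENNReal.ofReal (1 / (n + 2)) := by
    have : ∀ r : ℝ, (Set.Ioo (0 : ℝ) 1).indicator (1 : ℝ → ℝ≥0∞) r *
        ENNReal.ofReal (r ^ (n + 1)) =
        (Set.Ioo (0 : ℝ) 1).indicator (fun r => ENNReal.ofReal (r ^ (n + 1))) r := fun r => by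
      by_cases hr : r ∈ Set.Ioo (0 : ℝ) 1 <;> simp [hr]
    simp only [this]
    rw [lintegral_indicator measurableSet_Ioo, Measure.restrict_restrict measurableSet_Ioo,
      Set.inter_eq_self_of_subset_left fun r hr => hr.1, restrict_Ioo_eq_restrict_Ioc,
      ← ofReal_integral_eq_lintegral_ofReal, ← intervalIntegral.integral_of_le zero_le_one,
      integral_pow]
    · congr 1
      push_cast
      ring_nf
    · exact (intervalIntegrable_iff_integrableOn_Ioc_of_le zero_le_one).1
        (Continuous.intervalIntegrable (by fun_prop) _ _)
    · exact (ae_restrict_iff' measurableSet_Ioc).2 (Eventually.of_forall fun r hr => by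
        have := hr.1
        positivity)
  rw [hprod, hrad] at key
  have hset : (volume : Measure (EuclideanSpace ℝ (Fin (n + 2))))
      (Set.Ioo (0 : ℝ) 1 • (Subtype.val '' (angles n ⁻¹' Set.univ.pi s))) =
      ENNReal.ofReal (1 / (n + 2)) * ∏ i : Fin (n + 1), angleLaw i (s i) := by
    rw [← key]
    have hset' : (Set.Ioo (0 : ℝ) 1 • (Subtype.val '' (angles n ⁻¹' Set.univ.pi s)) :
        Set (EuclideanSpace ℝ (Fin (n + 2)))) =
        {x | ‖x‖ ∈ Set.Ioo (0 : ℝ) 1 ∧ ∀ i : Fin (n + 1), angle x (i + 1) ∈ s i} := by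
      ext x
      simp only [Set.mem_smul, Set.mem_image, Set.mem_preimage, Set.mem_univ_pi, Set.mem_ofPred_eq]
      constructor
      · rintro ⟨c, hc, _, ⟨u, hu, rfl⟩, rfl⟩
        refine ⟨?_, fun i => ?_⟩
        · simpa [norm_smul, abs_of_pos hc.1] using hc
        · rw [angle_smul hc.1]
          exact hu i
      · rintro ⟨hx, ha⟩
        have h0 : 0 < ‖x‖ := hx.1
        refine ⟨‖x‖, hx, ‖x‖⁻¹ • x, ⟨⟨‖x‖⁻¹ • x, by simp [norm_smul, h0.ne']⟩, fun i => ?_, rfl⟩,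
          by simp [smul_smul, h0.ne']⟩
        rw [angles]
        simp only
        rw [angle_smul (by positivity)]
        exact ha i
    have hmeas : MeasurableSet {x : EuclideanSpace ℝ (Fin (n + 2)) |
        ‖x‖ ∈ Set.Ioo (0 : ℝ) 1 ∧ ∀ i : Fin (n + 1), angle x (i + 1) ∈ s i} := by
      have : {x : EuclideanSpace ℝ (Fin (n + 2)) |
          ‖x‖ ∈ Set.Ioo (0 : ℝ) 1 ∧ ∀ i : Fin (n + 1), angle x (i + 1) ∈ s i} =
          (fun x => ‖x‖) ⁻¹' Set.Ioo (0 : ℝ) 1 ∩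
            ⋂ i : Fin (n + 1), (fun x => angle x (i + 1)) ⁻¹' s i := by
        ext x
        simp
      rw [this]
      exact (measurable_norm measurableSet_Ioo).inter
        (MeasurableSet.iInter fun i => measurable_angle _ (hs i))
    rw [hset', ← (PiLp.volume_preserving_toLp (Fin (n + 2))).measure_preimage
      hmeas.nullMeasurableSet,
      ← lintegral_indicator_one ((WithLp.measurable_toLp 2 _) hmeas)]
    refine lintegral_congr fun x => ?_
    rw [← Fin.prod_univ_eq_prod_range (fun i => h i (angle (WithLp.toLp 2 x) (i + 1)))]
    simp only [h, Fin.is_lt, dif_pos, Fin.eta, ← norm_eq_partialRadius]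
    by_cases hx : ‖(WithLp.toLp 2 x : EuclideanSpace ℝ (Fin (n + 2)))‖ ∈ Set.Ioo (0 : ℝ) 1
    · rw [Set.indicator_of_mem hx, Pi.one_apply, one_mul]
      by_cases ha : ∀ i : Fin (n + 1), angle (WithLp.toLp 2 x) (i + 1) ∈ s i
      · rw [Set.indicator_of_mem (by exact ⟨hx, ha⟩),
          Finset.prod_eq_one fun i _ => Set.indicator_of_mem (ha i) _]
        rfl
      · rw [Set.indicator_of_notMem fun hc => ha hc.2]
        push Not at ha
        obtain ⟨i, hi⟩ := ha
        exact (Finset.prod_eq_zero (Finset.mem_univ i) (Set.indicator_of_notMem hi _)).symm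
    · rw [Set.indicator_of_notMem hx, zero_mul, Set.indicator_of_notMem fun hc => hx hc.1]
  rw [hset, ← mul_assoc]
  -- The dimension `n + 2` cancels the radial integral `1 / (n + 2)`.
  convert one_mul _
  rw [finrank_euclideanSpace, Fintype.card_fin, ← ENNReal.ofReal_natCast,
    ← ENNReal.ofReal_mul (by positivity), ← ENNReal.ofReal_one]
  congr 1
  push_cast
  field_simp

theorem integral_prod_angles (n : ℕ) (F : Fin (n + 1) → ℝ → ℝ) (hF : ∀ i, Measurable (F i)) :
    ∫ x, ∏ i, F i (angles n x i) ∂surfaceMeasure (n + 2) =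
      ∏ i : Fin (n + 1), ∫ θ in (0 : ℝ)..angleTop i, F i θ * Real.sin θ ^ (i : ℕ) := by
  have hm : Measurable fun θ : Fin (n + 1) → ℝ => ∏ i, F i (θ i) :=
    Finset.measurable_prod _ fun i _ => (hF i).comp (measurable_pi_apply i)
  rw [← integral_map (φ := angles n) (f := fun θ => ∏ i, F i (θ i))
    (measurable_angles n).aemeasurable hm.aestronglyMeasurable, map_angles,
    integral_fintype_prod_eq_prod]
  exact Finset.prod_congr rfl fun i _ => integral_angleLaw i (F i)

/-! ### Trigonometric integrals -/

theorem integral_cos_int_mul (c : ℤ) :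
    ∫ s in (0 : ℝ)..2 * Real.pi, Real.cos (c * s) = if c = 0 then 2 * Real.pi else 0 := by
  split_ifs with h
  · simp [h]
  · have hc : (c : ℝ) ≠ 0 := Int.cast_ne_zero.2 h
    rw [intervalIntegral.integral_comp_mul_left _ hc, integral_cos]
    simp [show (c : ℝ) * (2 * Real.pi) = (2 * c : ℤ) * Real.pi by push_cast; ring,
      -Int.cast_mul, Real.sin_int_mul_pi]

/-- The integrand is odd under `s ↦ 2π - s`. -/
theorem integral_sin_nat_mul_comp_cos (c : ℕ) (G : ℝ → ℝ) :
    ∫ s in (0 : ℝ)..2 * Real.pi, Real.sin (c * s) * G (Real.cos s) = 0 := by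
  have h := intervalIntegral.integral_comp_sub_left (a := 0) (b := 2 * Real.pi)
    (fun s => Real.sin (c * s) * G (Real.cos s)) (2 * Real.pi)
  have h2 : ∀ s : ℝ, Real.sin (c * (2 * Real.pi - s)) * G (Real.cos (2 * Real.pi - s)) =
      -(Real.sin (c * s) * G (Real.cos s)) := fun s => by
    rw [mul_sub, Real.sin_nat_mul_two_pi_sub, Real.cos_two_pi_sub]
    ring
  simp only [h2, sub_self, sub_zero, intervalIntegral.integral_neg] at h
  linarith

theorem integral_cos_mul_cos (a b : ℕ) :
    ∫ s in (0 : ℝ)..2 * Real.pi, Real.cos (a * s) * Real.cos (b * s) =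
      if a = b then (if a = 0 then 2 * Real.pi else Real.pi) else 0 := by
  have h : ∀ s : ℝ, Real.cos (a * s) * Real.cos (b * s) =
      1 / 2 * (Real.cos (((a : ℤ) - b : ℤ) * s) + Real.cos (((a : ℤ) + b : ℤ) * s)) := fun s => by
    push_cast
    rw [sub_mul, add_mul, Real.cos_sub, Real.cos_add]
    ring
  simp only [h]
  rw [intervalIntegral.integral_const_mul, intervalIntegral.integral_add
    (Continuous.intervalIntegrable (by fun_prop) _ _)
    (Continuous.intervalIntegrable (by fun_prop) _ _), integral_cos_int_mul, integral_cos_int_mul]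
  split_ifs <;> first | omega | ring

theorem integral_sin_mul_sin (a b : ℕ) :
    ∫ s in (0 : ℝ)..2 * Real.pi, Real.sin (((a : ℝ) + 1) * s) * Real.sin (((b : ℝ) + 1) * s) =
      if a = b then Real.pi else 0 := by
  have h : ∀ s : ℝ, Real.sin (((a : ℝ) + 1) * s) * Real.sin (((b : ℝ) + 1) * s) =
      1 / 2 * (Real.cos (((a : ℤ) - b : ℤ) * s) - Real.cos (((a : ℤ) + b + 2 : ℤ) * s)) :=
    fun s => by
    have h1 : (((a : ℤ) - b : ℤ) : ℝ) * s = ((a : ℝ) + 1) * s - ((b : ℝ) + 1) * s := by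
      push_cast; ring
    have h2 : (((a : ℤ) + b + 2 : ℤ) : ℝ) * s = ((a : ℝ) + 1) * s + ((b : ℝ) + 1) * s := by
      push_cast; ring
    rw [h1, h2, Real.cos_sub, Real.cos_add]
    ring
  simp only [h]
  rw [intervalIntegral.integral_const_mul, intervalIntegral.integral_sub
    (Continuous.intervalIntegrable (by fun_prop) _ _)
    (Continuous.intervalIntegrable (by fun_prop) _ _), integral_cos_int_mul, integral_cos_int_mul]
  split_ifs <;> first | omega | ring

theorem integral_sin_mul_cos (a b : ℕ) :
    ∫ s in (0 : ℝ)..2 * Real.pi, Real.sin (((a : ℝ) + 1) * s) * Real.cos (b * s) = 0 := by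
  -- The function `cos (b s)` is the Chebyshev polynomial `T_b` evaluated at `cos s`.
  have := integral_sin_nat_mul_comp_cos (a + 1) fun y => (Polynomial.Chebyshev.T ℝ b).eval y
  simpa [Polynomial.Chebyshev.T_real_cos] using this

theorem continuous_zeta {p : ℕ} (m : Fin p → ℕ) : Continuous (zeta m) := by
  unfold zeta
  split <;> fun_prop

theorem integral_zeta_mul_zeta {p : ℕ} {m m' : Fin p → ℕ} (hm : ent m p ≤ 1) (hm' : ent m' p ≤ 1) :
    ∫ s in (0 : ℝ)..2 * Real.pi, zeta m s * zeta m' s =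
      if ent m (p - 1) = ent m' (p - 1) ∧ ent m p = ent m' p then
        (if 0 < ent m (p - 1) + ent m p then Real.pi else 2 * Real.pi) else 0 := by
  unfold zeta
  by_cases h : ent m p = 0 <;> by_cases h' : ent m' p = 0
  · simp only [h, h', if_true, integral_cos_mul_cos]
    by_cases e : ent m (p - 1) = ent m' (p - 1) <;> by_cases e0 : ent m' (p - 1) = 0 <;>
      simp [e, e0, Nat.pos_iff_ne_zero]
  · have e : ent m' p = 1 := by omega
    simp only [h, e, if_true, mul_comm (Real.cos _)]
    simpa using integral_sin_mul_cos _ _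
  · have e : ent m p = 1 := by omega
    simp only [h', e, if_true, one_ne_zero, if_false, integral_sin_mul_cos]
    simp
  · have e : ent m p = 1 := by omega
    have e' : ent m' p = 1 := by omega
    simp only [e, e', one_ne_zero, if_false, integral_sin_mul_sin]
    by_cases e : ent m (p - 1) = ent m' (p - 1) <;> simp [e]

/-! ### Product structure of the basis functions -/

/-- Translates from entries to angles: entry `j ≤ n` belongs to the zero-based angle `n + 1 - j`,
and angle `0` carries the trigonometric factor. -/
theorem mul_prod_Icc_eq_prod_fin (n : ℕ) (a : ℝ) (g : ℕ → ℝ) :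
    a * ∏ j ∈ Finset.Icc 1 n, g j = ∏ i : Fin (n + 1), if (i : ℕ) = 0 then a else g (n + 1 - i) := by
  rw [Fin.prod_univ_succ]
  simp only [Fin.val_zero, if_true, Fin.val_succ, Nat.add_eq_zero_iff, one_ne_zero, and_false,
    if_false]
  congr 1
  rw [Fin.prod_univ_eq_prod_range (fun i => g (n + 1 - (i + 1))) n]
  refine Finset.prod_bij' (fun j _ => n - j) (fun i _ => n - i) ?_ ?_ ?_ ?_ ?_
  · intro j hj
    have := Finset.mem_Icc.1 hj
    exact Finset.mem_range.2 (by omega)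
  · intro j hj
    have := Finset.mem_range.1 hj
    exact Finset.mem_Icc.2 (by omega)
  · intro j hj
    have := Finset.mem_Icc.1 hj
    omega
  · intro j hj
    have := Finset.mem_range.1 hj
    omega
  · intro j hj
    have := Finset.mem_Icc.1 hj
    congr 1
    omega

/-- The factor of the basis function that depends on the `(i + 1)`-st angle. -/
def harmFactor {n : ℕ} (m : Fin (n + 2) → ℕ) (i : ℕ) (θ : ℝ) : ℝ :=
  if i = 0 then zeta m θ else
    Real.sin θ ^ tailSum m (n + 2 - i) *
      gegenbauer ((2 * tailSum m (n + 2 - i) + i : ℕ) / 2) (ent m (n + 1 - i)) (Real.cos θ)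

/-- The factor of the squared normalization constant that belongs to the `(i + 1)`-st angle. -/
def normFactor {n : ℕ} (m : Fin (n + 2) → ℕ) (i : ℕ) : ℝ :=
  if i = 0 then (if 0 < ent m (n + 1) + ent m (n + 2) then 2 else 1) else
    ((ent m (n + 1 - i)).factorial * poch (((i : ℝ) + 2) / 2) (tailSum m (n + 2 - i)) *
        (ent m (n + 1 - i) + (2 * tailSum m (n + 2 - i) + i : ℕ) / 2)) /
      (poch (2 * tailSum m (n + 2 - i) + i : ℕ) (ent m (n + 1 - i)) *
        poch (((i : ℝ) + 1) / 2) (tailSum m (n + 2 - i)) *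
        ((2 * tailSum m (n + 2 - i) + i : ℕ) / 2))

theorem lamIdx_sub {n i : ℕ} (m : Fin (n + 2) → ℕ) (hi : i ≤ n + 1) :
    lamIdx m (n + 1 - i) = (2 * tailSum m (n + 2 - i) + i : ℕ) / 2 := by
  rw [lamIdx, show n + 1 - i + 1 = n + 2 - i by omega, Nat.cast_sub hi]
  push_cast
  ring

theorem normB_eq_prod {n : ℕ} (m : Fin (n + 2) → ℕ) :
    normB m = ∏ i : Fin (n + 1), normFactor m i := by
  rw [normB, show n + 2 - 2 = n by omega, mul_prod_Icc_eq_prod_fin]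
  refine Finset.prod_congr rfl fun i _ => ?_
  unfold normFactor
  by_cases h0 : (i : ℕ) = 0
  · rw [if_pos h0, if_pos h0]
    rfl
  · rw [if_neg h0, if_neg h0, lamIdx_sub m (by omega), show n + 1 - (i : ℕ) + 1 = n + 2 - i by omega,
      Nat.cast_sub (by omega : (i : ℕ) ≤ n + 1)]
    rw [show 2 * (((2 * tailSum m (n + 2 - i) + i : ℕ) : ℝ) / 2) =
      ((2 * tailSum m (n + 2 - i) + i : ℕ) : ℝ) by ring,
      show (((n + 2 : ℕ) : ℝ) - ((n + 1 : ℕ) - (i : ℕ)) + 1) = (i : ℕ) + 2 by push_cast; ring,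
      show (((n + 2 : ℕ) : ℝ) - ((n + 1 : ℕ) - (i : ℕ))) = (i : ℕ) + 1 by push_cast; ring]

theorem harmBasis_eq_prod {n : ℕ} (m : Fin (n + 2) → ℕ) (x : USphere (n + 2)) :
    harmBasis m x = √(normB m) * ∏ i : Fin (n + 1), harmFactor m i (angles n x i) := by
  rw [harmBasis, mul_assoc, show n + 2 - 2 = n by omega, mul_prod_Icc_eq_prod_fin]
  congr 1
  refine Finset.prod_congr rfl fun i _ => ?_
  unfold harmFactor angles
  split_ifs with h0
  · rw [h0]
  · rw [lamIdx_sub m (by omega), show n + 1 - (i : ℕ) + 1 = n + 2 - i by omega,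
      show n + 2 - (n + 1 - (i : ℕ)) = i + 1 by omega]

theorem continuous_gegenbauer (lam : ℝ) (q : ℕ) : Continuous (gegenbauer lam q) := by
  unfold gegenbauer
  split <;> fun_prop

theorem continuous_harmFactor {n : ℕ} (m : Fin (n + 2) → ℕ) (i : ℕ) :
    Continuous (harmFactor m i) := by
  unfold harmFactor
  split
  · exact continuous_zeta m
  · exact (Real.continuous_sin.pow _).mul ((continuous_gegenbauer _ _).comp Real.continuous_cos)

theorem angles_mem (n : ℕ) (x : USphere (n + 2)) (i : Fin (n + 1)) :
    angles n x i ∈ Set.Icc 0 (2 * Real.pi) := by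
  have h := hyperPoint_angle (by omega) x
  unfold angles
  by_cases hi : (i : ℕ) = 0
  · rw [hi]
    exact ⟨h.1.1, h.1.2.le⟩
  · have := h.2.1 (i + 1) (Finset.mem_Icc.2 (by omega))
    exact ⟨this.1, this.2.trans (by linarith [Real.pi_pos])⟩

theorem exists_abs_harmBasis_le {n : ℕ} (m : Fin (n + 2) → ℕ) :
    ∃ C, ∀ x : USphere (n + 2), |harmBasis m x| ≤ C := by
  have h : ∀ i : Fin (n + 1), ∃ C, ∀ θ ∈ Set.Icc 0 (2 * Real.pi), ‖harmFactor m i θ‖ ≤ C :=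
    fun i => isCompact_Icc.exists_bound_of_continuousOn (continuous_harmFactor m i).continuousOn
  choose C hC using h
  refine ⟨√(normB m) * ∏ i, C i, fun x => ?_⟩
  rw [harmBasis_eq_prod, abs_mul, abs_of_nonneg (Real.sqrt_nonneg _), Finset.abs_prod]
  exact mul_le_mul_of_nonneg_left (Finset.prod_le_prod (fun _ _ => abs_nonneg _)
    fun i _ => hC i _ (angles_mem n x i)) (Real.sqrt_nonneg _)

theorem measurable_harmBasis {n : ℕ} (m : Fin (n + 2) → ℕ) :
    Measurable (harmBasis m : USphere (n + 2) → ℝ) := by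
  have : (harmBasis m : USphere (n + 2) → ℝ) = fun x =>
      √(normB m) * ∏ i : Fin (n + 1), harmFactor m i (angles n x i) :=
    funext (harmBasis_eq_prod m)
  rw [this]
  exact (Finset.measurable_prod _ fun (i : Fin (n + 1)) _ => (continuous_harmFactor m i).measurable.comp
    (measurable_pi_iff.1 (measurable_angles n) i)).const_mul _

/-! ### Orthonormality -/

/-- The inner product of the factors of two basis functions that belong to the same angle. -/
def factorInner {n : ℕ} (m m' : Fin (n + 2) → ℕ) (i : ℕ) : ℝ :=
  ∫ θ in (0 : ℝ)..angleTop i, harmFactor m i θ * harmFactor m' i θ * Real.sin θ ^ i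

theorem integral_harmBasis_mul {n : ℕ} (m m' : Fin (n + 2) → ℕ) :
    ∫ x, harmBasis m x * harmBasis m' x ∂surfaceMeasure (n + 2) =
      √(normB m) * √(normB m') * ∏ i : Fin (n + 1), factorInner m m' i := by
  have h := integral_prod_angles n (fun i θ => harmFactor m i θ * harmFactor m' i θ) fun i =>
    ((continuous_harmFactor m i).mul (continuous_harmFactor m' i)).measurable
  unfold factorInner
  rw [← h, ← integral_const_mul]
  congr 1
  ext x
  rw [harmBasis_eq_prod, harmBasis_eq_prod, Finset.prod_mul_distrib]
  ring

/-- With `s` the common tail sum, the two factors contribute `sin ^ (2 s)` and the surface measure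
`sin ^ i`. The total exponent `2 s + i` is twice the Gegenbauer parameter, exactly the weight of
orthogonality. -/
theorem factorInner_succ {n : ℕ} {m m' : Fin (n + 2) → ℕ} {i : ℕ} (hi : i ≠ 0)
    (h : tailSum m (n + 2 - i) = tailSum m' (n + 2 - i)) :
    factorInner m m' i = gegInner (2 * tailSum m (n + 2 - i) + i) (ent m (n + 1 - i))
      (ent m' (n + 1 - i)) := by
  rw [factorInner, gegInner, angleTop, if_neg hi]
  congr 1
  ext θ
  rw [harmFactor, harmFactor, if_neg hi, if_neg hi, ← h]
  ring

theorem factorInner_zero {n : ℕ} {m m' : Fin (n + 2) → ℕ} (hm : ent m (n + 2) ≤ 1)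
    (hm' : ent m' (n + 2) ≤ 1) :
    factorInner m m' 0 =
      if ent m (n + 1) = ent m' (n + 1) ∧ ent m (n + 2) = ent m' (n + 2) then
        (if 0 < ent m (n + 1) + ent m (n + 2) then Real.pi else 2 * Real.pi) else 0 := by
  have := integral_zeta_mul_zeta hm hm'
  simpa [factorInner, harmFactor, angleTop] using this

theorem normFactor_nonneg {n : ℕ} (m : Fin (n + 2) → ℕ) (i : ℕ) : 0 ≤ normFactor m i := by
  unfold normFactor
  split_ifs with h
  · norm_num
  · norm_num
  · have hN : (0 : ℝ) < (2 * tailSum m (n + 2 - i) + i : ℕ) := by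
      exact_mod_cast (by omega : 0 < 2 * tailSum m (n + 2 - i) + i)
    have h1 := poch_pos hN (ent m (n + 1 - i))
    have h2 := poch_pos (show (0 : ℝ) < ((i : ℝ) + 1) / 2 by positivity) (tailSum m (n + 2 - i))
    have h3 := poch_pos (show (0 : ℝ) < ((i : ℝ) + 2) / 2 by positivity) (tailSum m (n + 2 - i))
    positivity

theorem normB_nonneg {n : ℕ} (m : Fin (n + 2) → ℕ) : 0 ≤ normB m := by
  rw [normB_eq_prod]
  exact Finset.prod_nonneg fun i _ => normFactor_nonneg m i

theorem normFactor_mul_factorInner {n : ℕ} {m : Fin (n + 2) → ℕ} (hm : ent m (n + 2) ≤ 1) (i : ℕ) :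
    normFactor m i * factorInner m m i = ∫ θ in (0 : ℝ)..angleTop i, Real.sin θ ^ i := by
  by_cases hi : i = 0
  · subst hi
    rw [factorInner_zero hm hm, normFactor, if_pos rfl, angleTop, if_pos rfl]
    simp only [and_self, if_true]
    split_ifs <;> simp
  · have hN' : 0 < 2 * tailSum m (n + 2 - i) + i := by omega
    have hN : (0 : ℝ) < (2 * tailSum m (n + 2 - i) + i : ℕ) := by exact_mod_cast hN'
    rw [factorInner_succ hi rfl, gegInner_self hN', normFactor, if_neg hi, angleTop, if_neg hi,
      add_comm (2 * tailSum m (n + 2 - i)) i, integral_sin_pow_add_two_mul]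
    rw [add_comm (2 * tailSum m (n + 2 - i)) i] at hN
    have h1 := poch_pos hN (ent m (n + 1 - i))
    have h2 := poch_pos (show (0 : ℝ) < ((i : ℝ) + 1) / 2 by positivity) (tailSum m (n + 2 - i))
    have h3 := poch_pos (show (0 : ℝ) < ((i : ℝ) + 2) / 2 by positivity) (tailSum m (n + 2 - i))
    generalize ((i + 2 * tailSum m (n + 2 - i) : ℕ) : ℝ) = N at *
    have h4 : ((ent m (n + 1 - i) : ℕ) : ℝ) + N / 2 ≠ 0 := by positivity
    have h5 : ((ent m (n + 1 - i)).factorial : ℝ) ≠ 0 := by positivity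
    generalize ∫ t in (0 : ℝ)..Real.pi, Real.sin t ^ i = J
    field_simp

theorem exists_last_ne {p : ℕ} {m m' : Fin p → ℕ} (h : m ≠ m') :
    ∃ j, 1 ≤ j ∧ j ≤ p ∧ ent m j ≠ ent m' j ∧ ∀ l, j < l → ent m l = ent m' l := by
  obtain ⟨a, ha⟩ := Function.ne_iff.1 h
  let P : ℕ → Prop := fun j => ent m j ≠ ent m' j
  classical
  have hPa : P (a + 1) := by simpa [P, ent] using ha
  have hle : ∀ j, P j → 1 ≤ j ∧ j ≤ p := fun j hj => by
    by_contra hc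
    exact hj (by rw [ent, ent, dif_neg hc, dif_neg hc])
  refine ⟨Nat.findGreatest P p, ?_, Nat.findGreatest_le p, ?_, fun l hl => ?_⟩
  · exact (hle _ (Nat.findGreatest_spec (hle _ hPa).2 hPa)).1
  · exact Nat.findGreatest_spec (hle _ hPa).2 hPa
  · by_contra hc
    exact Nat.findGreatest_is_greatest hl (hle l hc).2 hc

theorem factorInner_eq_zero {n : ℕ} {m m' : Fin (n + 2) → ℕ} (hm : ent m (n + 2) ≤ 1)
    (hm' : ent m' (n + 2) ≤ 1) {j : ℕ} (h1 : 1 ≤ j) (h2 : j ≤ n + 2) (hj : ent m j ≠ ent m' j)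
    (hl : ∀ l, j < l → ent m l = ent m' l) : factorInner m m' (n + 1 - j) = 0 := by
  by_cases hjn : j ≤ n
  · have hi : n + 1 - j ≠ 0 := by omega
    have hs : tailSum m (n + 2 - (n + 1 - j)) = tailSum m' (n + 2 - (n + 1 - j)) :=
      Finset.sum_congr rfl fun l h => hl l (by have := (Finset.mem_Icc.1 h).1; omega)
    rw [factorInner_succ hi hs, gegInner_of_ne (by omega)]
    rwa [show n + 1 - (n + 1 - j) = j by omega]
  -- The last two entries both belong to the first angle; for `j = n + 2` the subtraction truncates
  -- to `0`.
  · rw [show n + 1 - j = 0 by omega, factorInner_zero hm hm', if_neg]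
    rintro ⟨e1, e2⟩
    rcases (by omega : j = n + 1 ∨ j = n + 2) with rfl | rfl
    · exact hj e1
    · exact hj e2

theorem integral_harmBasis_mul_of_ne {n : ℕ} {m m' : Fin (n + 2) → ℕ} (hm : ent m (n + 2) ≤ 1)
    (hm' : ent m' (n + 2) ≤ 1) (h : m ≠ m') :
    ∫ x, harmBasis m x * harmBasis m' x ∂surfaceMeasure (n + 2) = 0 := by
  obtain ⟨j, h1, h2, hj, hl⟩ := exists_last_ne h
  rw [integral_harmBasis_mul, Finset.prod_eq_zero (Finset.mem_univ (⟨n + 1 - j, by omega⟩ : Fin _))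
    (factorInner_eq_zero hm hm' h1 h2 hj hl), mul_zero]

theorem integral_harmBasis_mul_self {n : ℕ} {m : Fin (n + 2) → ℕ} (hm : ent m (n + 2) ≤ 1) :
    ∫ x, harmBasis m x * harmBasis m x ∂surfaceMeasure (n + 2) =
      ∫ _, (1 : ℝ) ∂surfaceMeasure (n + 2) := by
  rw [integral_harmBasis_mul, Real.mul_self_sqrt (normB_nonneg m), normB_eq_prod,
    ← Finset.prod_mul_distrib]
  have h := integral_prod_angles n (fun _ _ => 1) fun _ => measurable_const
  simp only [Finset.prod_const_one, one_mul] at h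
  rw [h]
  exact Finset.prod_congr rfl fun i _ => normFactor_mul_factorInner hm i

/-! ### The zonal basis function and the mean of the others -/

theorem inner_poleVec {n : ℕ} (x : USphere (n + 2)) :
    inner ℝ x.1 (poleVec (n + 2)) = Real.cos (angles n x (Fin.last n)) := by
  have h := (hyperPoint_angle (by omega) x).2.2 (n + 2) (Finset.mem_Icc.2 (by omega))
  rw [hyperPoint, if_neg (by omega), Finset.Icc_eq_empty (by omega), Finset.prod_empty,
    mul_one] at h
  have h1 : inner ℝ x.1 (poleVec (n + 2)) = x.1 (Fin.last (n + 1)) := by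
    rw [PiLp.inner_apply, Finset.sum_eq_single (Fin.last (n + 1))]
    · simp [poleVec]
    · intro b _ hb
      have : (b : ℕ) ≠ n + 1 := fun hc => hb (Fin.ext hc)
      simp [poleVec, this]
    · simp
  rw [h1, angles]
  simp only [Fin.val_last]
  rw [show n + 2 - 1 = n + 1 by omega] at h
  rw [h, ent, dif_pos (by omega)]
  rfl

theorem ent_single_of_ne {n k l : ℕ} (hl : l ≠ 1) :
    ent (Pi.single (0 : Fin (n + 2)) k) l = 0 := by
  unfold ent
  split_ifs with h
  · rw [Pi.single_eq_of_ne]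
    simp [Fin.ext_iff]
    omega
  · rfl

theorem ent_single_one {n k : ℕ} : ent (Pi.single (0 : Fin (n + 2)) k) 1 = k := by
  simp [ent]

theorem tailSum_single {n k l : ℕ} (hl : 2 ≤ l) :
    tailSum (Pi.single (0 : Fin (n + 2)) k) l = 0 :=
  Finset.sum_eq_zero fun i hi => ent_single_of_ne (by have := (Finset.mem_Icc.1 hi).1; omega)

theorem factorial_mul_choose_eq_poch (n k : ℕ) :
    (k.factorial : ℝ) * (n + k).choose n = poch (n + 1) k := by
  induction k with
  | zero => simp
  | succ k ih =>
    rw [poch_succ, ← ih]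
    have h := Nat.add_choose_mul_factorial_mul_factorial n k
    have h' := Nat.add_choose_mul_factorial_mul_factorial n (k + 1)
    rw [← Nat.choose_symm_add] at h h'
    rw [← add_assoc, Nat.factorial_succ (n + k), ← h] at h'
    have hn : (n.factorial : ℝ) ≠ 0 := by positivity
    have h2 : ((n + (k + 1)).choose n * (n.factorial) * ((k + 1).factorial) : ℝ) =
        (n + k + 1) * ((n + k).choose n * n.factorial * k.factorial) := by
      exact_mod_cast h'
    apply mul_right_cancel₀ hn
    rw [show ((k + 1).factorial : ℝ) * (n + (k + 1)).choose n * n.factorial =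
      (n + (k + 1)).choose n * (n.factorial) * ((k + 1).factorial) by ring, h2]
    ring

/-- This is the identity `B_m = t_{p,k}²` for `p ≥ 3`. Only the last angle contributes a nontrivial
factor, and `d_{p,k}` comes out of Pochhammer symbols via `factorial_mul_choose_eq_poch`. -/
theorem normB_single {n k : ℕ} (hn : n ≠ 0) (hk : 1 ≤ k) :
    normB (Pi.single (0 : Fin (n + 2)) k) =
      (1 + 2 * (k : ℝ) / n) ^ 2 / harmDim (n + 2) k := by
  rw [normB_eq_prod, Finset.prod_eq_single (Fin.last n)]
  · rw [normFactor, Fin.val_last, if_neg hn, tailSum_single (by omega),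
      show n + 1 - n = 1 by omega, ent_single_one]
    obtain ⟨k, rfl⟩ : ∃ l, k = l + 1 := ⟨k - 1, by omega⟩
    have e1 := factorial_mul_choose_eq_poch n k
    have e2 := factorial_mul_choose_eq_poch n (k + 1)
    rw [poch_succ] at e2
    have hn' : (0 : ℝ) < n := by positivity
    rw [harmDim, show n + 2 + (k + 1) - 3 = n + k by omega, show n + 2 - 2 = n by omega,
      show n + 2 + (k + 1) - 2 = n + (k + 1) by omega]
    have hP := poch_pos (show (0 : ℝ) < n + 1 by positivity) k
    have hd : (((n + k).choose n + (n + (k + 1)).choose n : ℕ) : ℝ) =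
        poch (n + 1) k * (n + 2 * (k + 1)) / (k + 1).factorial := by
      rw [eq_div_iff (by positivity)]
      push_cast
      rw [add_mul, mul_comm (((n + (k + 1)).choose n : ℕ) : ℝ), e2, Nat.factorial_succ]
      push_cast
      rw [show ((n + k).choose n : ℝ) * ((k + 1) * k.factorial) =
        (k + 1) * (k.factorial * (n + k).choose n) by ring, e1]
      ring
    rw [hd]
    simp only [poch_zero, mul_zero, zero_add, mul_one]
    rw [poch_succ_left]
    have : ((k + 1).factorial : ℝ) ≠ 0 := by positivity
    push_cast
    field_simp
    ring
  · intro i _ hi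
    have hi' : (i : ℕ) ≠ n := fun hc => hi (Fin.ext hc)
    unfold normFactor
    rw [tailSum_single (by omega), ent_single_of_ne (by omega), ent_single_of_ne (by omega),
      ent_single_of_ne (by omega)]
    split_ifs with h0 h1
    · omega
    · rfl
    · have : ((i : ℕ) : ℝ) ≠ 0 := Nat.cast_ne_zero.2 h0
      simp [this]
  · simp

theorem harmBasis_single {n k : ℕ} (hk : 1 ≤ k) (x : USphere (n + 2)) :
    harmBasis (Pi.single (0 : Fin (n + 2)) k) x =
      tCoef (n + 2) k * gegenbauer (n / 2) k (Real.cos (angles n x (Fin.last n))) := by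
  rw [harmBasis_eq_prod, tCoef]
  by_cases hn : n = 0
  · subst hn
    have : normB (Pi.single (0 : Fin 2) k) = 2 := by
      simp [normB, ent, show 0 < k by omega]
    rw [this]
    simp [gegenbauer, harmFactor, zeta, ent, Polynomial.Chebyshev.T_real_cos]
  · rw [if_neg (by omega), normB_single hn hk, Real.sqrt_div (by positivity),
      Real.sqrt_sq (by positivity)]
    congr 1
    · push_cast
      ring_nf
    · rw [Finset.prod_eq_single (Fin.last n)]
      · rw [harmFactor, Fin.val_last, if_neg hn, tailSum_single (by omega),
          show n + 1 - n = 1 by omega, ent_single_one]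
        simp
      · intro i _ hi
        have hi' : (i : ℕ) ≠ n := fun hc => hi (Fin.ext hc)
        unfold harmFactor
        split_ifs with h0
        · simp [zeta, ent_single_of_ne]
          rw [ent_single_of_ne (by omega)]
          simp
        · rw [tailSum_single (by omega), ent_single_of_ne (by omega),
            gegenbauer_zero_right (by positivity)]
          simp
      · simp

theorem harmFactor_zero {n i : ℕ} (θ : ℝ) :
    harmFactor (0 : Fin (n + 2) → ℕ) i θ = 1 := by
  have h : ∀ l, ent (0 : Fin (n + 2) → ℕ) l = 0 := fun l => by
    unfold ent
    split <;> rfl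
  unfold harmFactor
  split_ifs with h0
  · simp [zeta, h]
  · rw [h, show tailSum (0 : Fin (n + 2) → ℕ) (n + 2 - i) = 0 from Finset.sum_eq_zero fun l _ => h l,
      gegenbauer_zero_right (by positivity)]
    simp

theorem harmBasis_zero {n : ℕ} (x : USphere (n + 2)) :
    harmBasis (0 : Fin (n + 2) → ℕ) x = 1 := by
  have h : ∀ l, ent (0 : Fin (n + 2) → ℕ) l = 0 := fun l => by
    unfold ent
    split <;> rfl
  have hB : normB (0 : Fin (n + 2) → ℕ) = 1 := by
    rw [normB_eq_prod]
    refine Finset.prod_eq_one fun i _ => ?_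
    unfold normFactor
    rw [show tailSum (0 : Fin (n + 2) → ℕ) (n + 2 - i) = 0 from Finset.sum_eq_zero fun l _ => h l,
      h, h, h]
    split_ifs with h0 h1
    · omega
    · rfl
    · have : ((i : ℕ) : ℝ) ≠ 0 := Nat.cast_ne_zero.2 h0
      simp [this]
  rw [harmBasis_eq_prod, hB, Finset.prod_eq_one fun i _ => harmFactor_zero _]
  simp

/-- For `p ≥ 3`, comparison with the zero index singles out the last nonzero entry. Its angle is not
the last one, so `G` leaves that factor untouched and it is orthogonal to `1`. -/
theorem integral_harmBasis_mul_comp_cos {n : ℕ} {m : Fin (n + 2) → ℕ} (hm : ent m (n + 2) ≤ 1)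
    {j : ℕ} (hj : 2 ≤ j) (hmj : ent m j ≠ 0) {G : ℝ → ℝ} (hG : Measurable G) :
    ∫ x, harmBasis m x * G (Real.cos (angles n x (Fin.last n))) ∂surfaceMeasure (n + 2) = 0 := by
  have h0 : ∀ l, ent (0 : Fin (n + 2) → ℕ) l = 0 := fun l => by
    unfold ent
    split <;> rfl
  let F : Fin (n + 1) → ℝ → ℝ := fun i θ =>
    harmFactor m i θ * if i = Fin.last n then G (Real.cos θ) else 1
  have hF : ∀ i, Measurable (F i) := fun i => by
    refine (continuous_harmFactor m i).measurable.mul ?_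
    split
    · exact hG.comp Real.measurable_cos
    · exact measurable_const
  have hprod : ∀ x, harmBasis m x * G (Real.cos (angles n x (Fin.last n))) =
      √(normB m) * ∏ i, F i (angles n x i) := fun x => by
    rw [harmBasis_eq_prod, Finset.prod_mul_distrib, Finset.prod_ite_eq' Finset.univ]
    simp [mul_assoc]
  simp only [hprod]
  rw [integral_const_mul, integral_prod_angles n F hF]
  obtain ⟨j', h1, h2, hj', hl⟩ := exists_last_ne (m := m) (m' := 0) (by rintro rfl; exact hmj (h0 j))
  have hjj : j ≤ j' := by
    by_contra hc
    exact hmj ((hl j (by omega)).trans (h0 j))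
  -- For `p = 2` the only angle also carries `G`, so orthogonality to constants is not enough; here
  -- `m_2 = 1`, and the sine factor is odd under reflection.
  by_cases hn : n = 0
  · subst hn
    obtain rfl : j' = 2 := by omega
    have e : ent m 2 ≠ 0 := by rwa [h0] at hj'
    have := integral_sin_nat_mul_comp_cos (ent m 1 + 1) G
    simp [F, harmFactor, zeta, e, angleTop]
    right
    simpa using this
  · have hz := factorInner_eq_zero hm (by rw [h0]; omega) h1 h2 hj' hl
    rw [Finset.prod_eq_zero (Finset.mem_univ (⟨n + 1 - j', by omega⟩ : Fin _)), mul_zero]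
    rw [← hz, factorInner]
    congr 1
    ext θ
    have : (⟨n + 1 - j', by omega⟩ : Fin (n + 1)) ≠ Fin.last n := by
      simp [Fin.ext_iff]
      omega
    simp only [F, this, if_false]
    rw [harmFactor_zero]

/-! ### The law of the last coordinate -/

instance (p : ℕ) : IsFiniteMeasure (surfaceMeasure p) := by
  unfold surfaceMeasure
  infer_instance

theorem sphereArea_pos (d : ℕ) : 0 < sphereArea (d + 1) := by
  unfold sphereArea
  have := Real.Gamma_pos_of_pos (show (0 : ℝ) < ((d + 1 : ℕ) : ℝ) / 2 by positivity)
  positivity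

theorem surfaceMeasure_univ (d : ℕ) :
    surfaceMeasure (d + 1) Set.univ = ENNReal.ofReal (sphereArea (d + 1)) := by
  have hd : (0 : ℝ) < ((d + 1 : ℕ) : ℝ) / 2 := by positivity
  have hG := Real.Gamma_pos_of_pos hd
  rw [surfaceMeasure, Measure.toSphere_apply_univ, EuclideanSpace.volume_ball,
    finrank_euclideanSpace, Fintype.card_fin, ENNReal.ofReal_one, one_pow, one_mul,
    ← ENNReal.ofReal_natCast, ← ENNReal.ofReal_mul (by positivity), sphereArea,
    Real.Gamma_add_one hd.ne', Real.sqrt_eq_rpow, ← Real.rpow_natCast, ← Real.rpow_mul Real.pi_pos.le]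
  congr 1
  rw [show (1 : ℝ) / 2 * ((d + 1 : ℕ) : ℝ) = ((d + 1 : ℕ) : ℝ) / 2 by ring]
  generalize ((d + 1 : ℕ) : ℝ) = a at *
  have : a ≠ 0 := by
    rintro rfl
    simp at hd
  field_simp

theorem lintegral_angles_last (n : ℕ) {φ : ℝ → ℝ≥0∞} (hφ : Measurable φ) :
    ∫⁻ x, φ (angles n x (Fin.last n)) ∂surfaceMeasure (n + 2) =
      (∏ i : Fin n, angleLaw i Set.univ) * ∫⁻ θ, φ θ ∂angleLaw n := by
  have he : Finset.univ.erase (Fin.last n) = Finset.univ.map Fin.castSuccEmb := by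
    ext i
    simp [Fin.exists_castSucc_eq]
  have h := lintegral_map (μ := surfaceMeasure (n + 2))
    (f := fun θ : Fin (n + 1) → ℝ => φ (Function.eval (Fin.last n) θ))
    (hφ.comp (measurable_pi_apply _)) (measurable_angles n)
  rw [map_angles, ← lintegral_map hφ (measurable_pi_apply _), Measure.pi_map_eval,
    lintegral_smul_measure, he, Finset.prod_map] at h
  exact h.symm

theorem prod_angleLaw_univ (n : ℕ) :
    ∏ i : Fin (n + 1), angleLaw i Set.univ = ENNReal.ofReal (sphereArea (n + 2)) := by
  rw [← surfaceMeasure_univ, ← Measure.pi_univ, ← map_angles,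
    Measure.map_apply (measurable_angles n) MeasurableSet.univ, Set.preimage_univ]

theorem lintegral_comp_cos (n : ℕ) (φ : ℝ → ℝ≥0∞) :
    ∫⁻ θ in Set.Ioc 0 Real.pi, ENNReal.ofReal (Real.sin θ ^ n) * φ (Real.cos θ) =
      ∫⁻ s in Set.Ioo (-1) 1, ENNReal.ofReal ((1 - s ^ 2) ^ ((((n + 2 : ℕ) : ℝ) - 3) / 2)) * φ s := by
  have himg : Real.cos '' Set.Ioo 0 Real.pi = Set.Ioo (-1) 1 := by
    ext s
    constructor
    · rintro ⟨θ, hθ, rfl⟩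
      have h1 := Real.strictAntiOn_cos ⟨le_rfl, Real.pi_pos.le⟩ ⟨hθ.1.le, hθ.2.le⟩ hθ.1
      have h2 := Real.strictAntiOn_cos ⟨hθ.1.le, hθ.2.le⟩ ⟨Real.pi_pos.le, le_rfl⟩ hθ.2
      rw [Real.cos_zero] at h1
      rw [Real.cos_pi] at h2
      exact ⟨h2, h1⟩
    · rintro ⟨h1, h2⟩
      exact ⟨Real.arccos s, ⟨Real.arccos_pos.2 h2, Real.arccos_lt_pi.2 h1⟩,
        Real.cos_arccos h1.le h2.le⟩
  rw [← himg, lintegral_image_eq_lintegral_abs_deriv_mul measurableSet_Ioo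
    (fun θ _ => (Real.hasDerivAt_cos θ).hasDerivWithinAt)
    (Real.injOn_cos.mono Set.Ioo_subset_Icc_self), ← restrict_Ioo_eq_restrict_Ioc]
  refine setLIntegral_congr_fun measurableSet_Ioo fun θ hθ => ?_
  have hs : 0 < Real.sin θ := Real.sin_pos_of_mem_Ioo hθ
  rw [← mul_assoc, ← ENNReal.ofReal_mul (abs_nonneg _), abs_neg, abs_of_pos hs, ← Real.sin_sq]
  congr 2
  rw [← Real.rpow_natCast (Real.sin θ) 2, ← Real.rpow_mul hs.le]
  nth_rewrite 2 [← Real.rpow_one (Real.sin θ)]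
  rw [← Real.rpow_add hs, ← Real.rpow_natCast]
  congr 1
  push_cast
  ring

theorem lintegral_comp_cos_two_pi {φ : ℝ → ℝ≥0∞} (hφ : Measurable φ) :
    ∫⁻ θ in Set.Ioc 0 (2 * Real.pi), φ (Real.cos θ) =
      2 * ∫⁻ θ in Set.Ioc 0 Real.pi, φ (Real.cos θ) := by
  have hm : Measurable fun θ => φ (Real.cos θ) := hφ.comp Real.measurable_cos
  have h := (Measure.measurePreserving_sub_left volume (2 * Real.pi)).setLIntegral_comp_preimage
    (measurableSet_Ioo (a := Real.pi) (b := 2 * Real.pi)) hm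
  have hpre : (fun t => 2 * Real.pi - t) ⁻¹' Set.Ioo Real.pi (2 * Real.pi) = Set.Ioo 0 Real.pi := by
    ext t
    simp only [Set.mem_preimage, Set.mem_Ioo]
    constructor <;> rintro ⟨h1, h2⟩ <;> constructor <;> linarith
  rw [hpre, restrict_Ioo_eq_restrict_Ioc, restrict_Ioo_eq_restrict_Ioc] at h
  simp only [Real.cos_two_pi_sub] at h
  have hpi := Real.pi_pos
  rw [← Set.Ioc_union_Ioc_eq_Ioc hpi.le (by linarith : Real.pi ≤ 2 * Real.pi),
    lintegral_union measurableSet_Ioc (Set.Ioc_disjoint_Ioc_of_le le_rfl), ← h, two_mul]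

theorem sphereArea_one : sphereArea 1 = 2 := by
  rw [sphereArea, Nat.cast_one, Real.Gamma_one_half_eq, Real.sqrt_eq_rpow]
  have : Real.pi ^ ((1 : ℝ) / 2) ≠ 0 := (Real.rpow_pos_of_pos Real.pi_pos _).ne'
  field_simp

/-- The other angles integrate to the area of `S^{p-2}`. For `p = 2` there are none, but the cosine
covers `(-1, 1)` twice on `(0, 2π]`, matching the area `2` of `S^0`. -/
theorem lintegral_comp_cos_last (n : ℕ) {φ : ℝ → ℝ≥0∞} (hφ : Measurable φ) :
    ∫⁻ x, φ (Real.cos (angles n x (Fin.last n))) ∂surfaceMeasure (n + 2) =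
      ENNReal.ofReal (sphereArea (n + 1)) * ∫⁻ s in Set.Ioo (-1) 1,
        ENNReal.ofReal ((1 - s ^ 2) ^ ((((n + 2 : ℕ) : ℝ) - 3) / 2)) * φ s := by
  have hm : Measurable fun θ => φ (Real.cos θ) := hφ.comp Real.measurable_cos
  rw [lintegral_angles_last n hm, lintegral_angleLaw n hm, ← lintegral_comp_cos]
  rcases n with _ | n
  · rw [Finset.univ_eq_empty, Finset.prod_empty, one_mul, angleTop, if_pos rfl, sphereArea_one]
    simp only [pow_zero, ENNReal.ofReal_one, one_mul, ENNReal.ofReal_ofNat]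
    exact lintegral_comp_cos_two_pi hφ
  · rw [prod_angleLaw_univ, angleTop, if_neg (by omega)]

/-! ### The alternatives -/

/-- The density of the alternatives with respect to `σ_p`, up to a constant factor. -/
def tilt {n : ℕ} (κ : ℝ) (f : ℝ → ℝ) (x : USphere (n + 2)) : ℝ :=
  f (κ * Real.cos (angles n x (Fin.last n)))

theorem measurable_cos_last (n : ℕ) :
    Measurable fun x : USphere (n + 2) => Real.cos (angles n x (Fin.last n)) :=
  Real.measurable_cos.comp (measurable_pi_iff.1 (measurable_angles n) _)

theorem tilt_nonneg {n : ℕ} (κ : ℝ) {f : ℝ → ℝ} (hf : IsAngular f) (x : USphere (n + 2)) :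
    0 ≤ tilt κ f x := hf.nonneg _

theorem measurable_tilt {n : ℕ} (κ : ℝ) {f : ℝ → ℝ} (hf : IsAngular f) :
    Measurable (tilt κ f : USphere (n + 2) → ℝ) :=
  hf.measurable.comp ((measurable_cos_last n).const_mul κ)

theorem altLaw_eq {n : ℕ} (κ : ℝ) (f : ℝ → ℝ) :
    altLaw (n + 2) κ f = ((ENNReal.ofReal (sphereArea (n + 1)))⁻¹ •
      surfaceMeasure (n + 2)).withDensity
        fun x => ENNReal.ofReal (normConst (n + 2) κ f * tilt κ f x) := by
  simp only [altLaw, rotSymm, inner_poleVec, tilt]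
  rfl

theorem normConst_nonneg (p : ℕ) (κ : ℝ) {f : ℝ → ℝ} (hf : IsAngular f) :
    0 ≤ normConst p κ f := by
  refine one_div_nonneg.2 (intervalIntegral.integral_nonneg (by norm_num) fun s hs => ?_)
  have : 0 ≤ 1 - s ^ 2 := by nlinarith [hs.1, hs.2]
  exact mul_nonneg (Real.rpow_nonneg this _) (hf.nonneg _)

theorem integral_altLaw {n : ℕ} (κ : ℝ) {f : ℝ → ℝ} (hf : IsAngular f) (F : USphere (n + 2) → ℝ) :
    ∫ x, F x ∂altLaw (n + 2) κ f = (sphereArea (n + 1))⁻¹ * normConst (n + 2) κ f *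
      ∫ x, F x * tilt κ f x ∂surfaceMeasure (n + 2) := by
  rw [altLaw_eq, integral_withDensity_eq_integral_toReal_smul
    ((measurable_tilt κ hf).const_mul _).ennreal_ofReal (by simp), integral_smul_measure,
    ENNReal.toReal_inv, ENNReal.toReal_ofReal (sphereArea_pos n).le, smul_eq_mul, mul_assoc,
    ← integral_const_mul (normConst _ _ _)]
  congr 2
  ext x
  rw [ENNReal.toReal_ofReal (mul_nonneg (normConst_nonneg _ _ hf) (tilt_nonneg κ hf x)), smul_eq_mul]
  ring

/-- Total mass one, that is `F = 1`, determines the constant in front, so its explicit value plays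
no role in the limits. -/
theorem integral_altLaw_eq_div {n : ℕ} {κ : ℝ} {f : ℝ → ℝ} (hf : IsAngular f)
    (hP : IsProbabilityMeasure (altLaw (n + 2) κ f)) (F : USphere (n + 2) → ℝ) :
    ∫ x, F x ∂altLaw (n + 2) κ f = (∫ x, F x * tilt κ f x ∂surfaceMeasure (n + 2)) /
      ∫ x, 1 * tilt κ f x ∂surfaceMeasure (n + 2) := by
  have h1 := integral_altLaw κ hf fun _ : USphere (n + 2) => 1
  rw [integral_const, probReal_univ, one_smul] at h1
  rw [integral_altLaw κ hf F]
  rw [eq_div_iff (fun h0 => by rw [h0, mul_zero] at h1; exact one_ne_zero h1), mul_right_comm,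
    ← h1, one_mul]

/-! ### Moments as the concentration tends to zero -/

theorem tilt_bounds {f : ℝ → ℝ} (hf : IsAngular f) (hf0 : ContinuousAt f 0) {κ : ℕ → ℝ}
    (hκ : Tendsto κ atTop (𝓝 0)) (n : ℕ) :
    ∀ᶠ k in atTop, ∀ x : USphere (n + 2), 1 / 2 ≤ tilt (κ k) f x ∧ tilt (κ k) f x ≤ 2 := by
  obtain ⟨δ, hδ, h⟩ := Metric.continuousAt_iff.1 hf0 (1 / 2) (by norm_num)
  filter_upwards [Metric.tendsto_atTop'.1 hκ δ hδ |>.elim fun N hN =>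
    eventually_gt_atTop N |>.mono hN] with k hk x
  have hx : dist (κ k * Real.cos (angles n x (Fin.last n))) 0 < δ := by
    rw [Real.dist_eq, sub_zero] at hk ⊢
    rw [abs_mul]
    exact (mul_le_of_le_one_right (abs_nonneg _) (Real.abs_cos_le_one _)).trans_lt hk
  have := h hx
  rw [hf.at_zero, Real.dist_eq, abs_lt] at this
  unfold tilt
  constructor <;> linarith [this.1, this.2]

theorem surfaceMeasure_real_univ (n : ℕ) :
    ∫ _, (1 : ℝ) ∂surfaceMeasure (n + 2) = sphereArea (n + 2) := by
  rw [integral_const, measureReal_def, surfaceMeasure_univ,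
    ENNReal.toReal_ofReal (sphereArea_pos _).le, smul_eq_mul, mul_one]

/-- The lower bound keeps the normalizing integral away from zero and the upper bound keeps it
finite. Only then is the real integral in `normConst` the true one rather than a default value, and
its reciprocal a genuine inverse. -/
theorem isProbabilityMeasure_altLaw {n : ℕ} {κ : ℝ} {f : ℝ → ℝ} (hf : IsAngular f)
    (hb : ∀ x : USphere (n + 2), 1 / 2 ≤ tilt κ f x ∧ tilt κ f x ≤ 2) :
    IsProbabilityMeasure (altLaw (n + 2) κ f) := by
  have hS := ENNReal.ofReal_pos.2 (sphereArea_pos n)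
  set A := ∫⁻ s in Set.Ioo (-1 : ℝ) 1,
    ENNReal.ofReal ((1 - s ^ 2) ^ ((((n + 2 : ℕ) : ℝ) - 3) / 2)) * ENNReal.ofReal (f (κ * s)) with hA
  have hAσ : ∫⁻ x : USphere (n + 2), ENNReal.ofReal (tilt κ f x) ∂surfaceMeasure (n + 2) =
      ENNReal.ofReal (sphereArea (n + 1)) * A :=
    lintegral_comp_cos_last n (φ := fun s => ENNReal.ofReal (f (κ * s)))
      (hf.measurable.comp (measurable_const_mul κ)).ennreal_ofReal
  have hσ := surfaceMeasure_univ (n + 1)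
  have hA0 : A ≠ 0 := by
    intro h0
    have : ∫⁻ x : USphere (n + 2), ENNReal.ofReal (1 / 2) ∂surfaceMeasure (n + 2) ≤ 0 := by
      rw [h0, mul_zero] at hAσ
      rw [← hAσ]
      exact lintegral_mono fun x => ENNReal.ofReal_le_ofReal (hb x).1
    rw [lintegral_const, hσ, nonpos_iff_eq_zero, mul_eq_zero, ENNReal.ofReal_eq_zero,
      ENNReal.ofReal_eq_zero] at this
    have := sphereArea_pos (n + 1)
    norm_num at *
    linarith
  have hAt : A ≠ ∞ := by
    intro h0
    have : ∫⁻ x : USphere (n + 2), ENNReal.ofReal (tilt κ f x) ∂surfaceMeasure (n + 2) ≤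
        ∫⁻ x : USphere (n + 2), ENNReal.ofReal 2 ∂surfaceMeasure (n + 2) :=
      lintegral_mono fun x => ENNReal.ofReal_le_ofReal (hb x).2
    rw [hAσ, h0, ENNReal.mul_top hS.ne', lintegral_const, hσ, top_le_iff,
      ← ENNReal.ofReal_mul (by norm_num)] at this
    exact ENNReal.ofReal_ne_top this
  have hc : normConst (n + 2) κ f = A.toReal⁻¹ := by
    rw [normConst, one_div, intervalIntegral.integral_of_le (by norm_num),
      ← restrict_Ioo_eq_restrict_Ioc, integral_eq_lintegral_of_nonneg_ae]
    · congr 2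
      refine setLIntegral_congr_fun measurableSet_Ioo fun s hs => ?_
      have : 0 ≤ 1 - s ^ 2 := by nlinarith [hs.1, hs.2]
      exact ENNReal.ofReal_mul (Real.rpow_nonneg this _)
    · refine (ae_restrict_iff' measurableSet_Ioo).2 (Eventually.of_forall fun s hs => ?_)
      have : 0 ≤ 1 - s ^ 2 := by nlinarith [hs.1, hs.2]
      exact mul_nonneg (Real.rpow_nonneg this _) (hf.nonneg _)
    · have h1 : Measurable fun s : ℝ => (1 - s ^ 2) ^ ((((n + 2 : ℕ) : ℝ) - 3) / 2) :=
        ((measurable_id.pow_const 2).const_sub 1).pow_const _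
      exact (h1.mul (hf.measurable.comp (measurable_const_mul κ))).aestronglyMeasurable
  constructor
  rw [altLaw_eq, withDensity_apply _ MeasurableSet.univ, Measure.restrict_univ,
    lintegral_smul_measure]
  simp only [ENNReal.ofReal_mul (normConst_nonneg _ κ hf)]
  rw [lintegral_const_mul _ (measurable_tilt κ hf).ennreal_ofReal, hAσ, hc,
    ENNReal.ofReal_inv_of_pos (ENNReal.toReal_pos hA0 hAt), ENNReal.ofReal_toReal hAt, smul_eq_mul,
    mul_left_comm A⁻¹, ENNReal.inv_mul_cancel hA0 hAt, mul_one,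
    ENNReal.inv_mul_cancel hS.ne' ENNReal.ofReal_ne_top]

theorem eventually_isProbabilityMeasure_altLaw {f : ℝ → ℝ} (hf : IsAngular f)
    (hf0 : ContinuousAt f 0) {κ : ℕ → ℝ} (hκ : Tendsto κ atTop (𝓝 0)) (n : ℕ) :
    ∀ᶠ k in atTop, IsProbabilityMeasure (altLaw (n + 2) (κ k) f) :=
  (tilt_bounds hf hf0 hκ n).mono fun _ hb => isProbabilityMeasure_altLaw hf hb

theorem tendsto_integral_mul_tilt {f : ℝ → ℝ} (hf : IsAngular f) (hf0 : ContinuousAt f 0)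
    {κ : ℕ → ℝ} (hκ : Tendsto κ atTop (𝓝 0)) {n : ℕ} {F : USphere (n + 2) → ℝ} (hF : Measurable F)
    {C : ℝ} (hC : ∀ x, |F x| ≤ C) :
    Tendsto (fun k => ∫ x, F x * tilt (κ k) f x ∂surfaceMeasure (n + 2)) atTop
      (𝓝 (∫ x, F x ∂surfaceMeasure (n + 2))) := by
  refine tendsto_integral_filter_of_dominated_convergence (fun _ => C * 2)
    (Eventually.of_forall fun k => (hF.mul (measurable_tilt _ hf)).aestronglyMeasurable) ?_
    (integrable_const _) (Eventually.of_forall fun x => ?_)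
  · filter_upwards [tilt_bounds hf hf0 hκ n] with k hk
    refine Eventually.of_forall fun x => ?_
    rw [Real.norm_eq_abs, abs_mul]
    refine mul_le_mul (hC x) ?_ (abs_nonneg _) ((abs_nonneg _).trans (hC x))
    rw [abs_of_nonneg (tilt_nonneg _ hf x)]
    exact (hk x).2
  · have h1 : Tendsto (fun k => κ k * Real.cos (angles n x (Fin.last n))) atTop (𝓝 0) := by
      simpa using hκ.mul_const (Real.cos (angles n x (Fin.last n)))
    have h2 := hf0.tendsto.comp h1
    rw [hf.at_zero] at h2
    simpa [tilt, Function.comp_def] using h2.const_mul (F x)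

theorem tendsto_integral_altLaw {f : ℝ → ℝ} (hf : IsAngular f) (hf0 : ContinuousAt f 0)
    {κ : ℕ → ℝ} (hκ : Tendsto κ atTop (𝓝 0)) {n : ℕ} {F : USphere (n + 2) → ℝ} (hF : Measurable F)
    {C : ℝ} (hC : ∀ x, |F x| ≤ C) :
    Tendsto (fun k => ∫ x, F x ∂altLaw (n + 2) (κ k) f) atTop
      (𝓝 ((∫ x, F x ∂surfaceMeasure (n + 2)) / ∫ _, (1 : ℝ) ∂surfaceMeasure (n + 2))) := by
  have h1 := tendsto_integral_mul_tilt hf hf0 hκ hF hC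
  have h2 := tendsto_integral_mul_tilt hf hf0 hκ (n := n) (F := fun _ => 1) measurable_const
    (C := 1) (by simp)
  refine (h1.div h2 ?_).congr' ?_
  · rw [surfaceMeasure_real_univ]
    exact (sphereArea_pos _).ne'
  · filter_upwards [eventually_isProbabilityMeasure_altLaw hf hf0 hκ n] with k hk
    exact (integral_altLaw_eq_div hf hk F).symm

theorem tendsto_integral_harmBasis_mul {f : ℝ → ℝ} (hf : IsAngular f) (hf0 : ContinuousAt f 0)
    {κ : ℕ → ℝ} (hκ : Tendsto κ atTop (𝓝 0)) {n : ℕ} {m m' : Fin (n + 2) → ℕ}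
    (hm : ent m (n + 2) ≤ 1) (hm' : ent m' (n + 2) ≤ 1) :
    Tendsto (fun k => ∫ x, harmBasis m x * harmBasis m' x ∂altLaw (n + 2) (κ k) f) atTop
      (𝓝 (if m = m' then 1 else 0)) := by
  obtain ⟨C, hC⟩ := exists_abs_harmBasis_le m
  obtain ⟨C', hC'⟩ := exists_abs_harmBasis_le m'
  have h := tendsto_integral_altLaw hf hf0 hκ
    ((measurable_harmBasis m).mul (measurable_harmBasis m')) (C := C * C') fun x => by
      rw [Pi.mul_apply, abs_mul]
      exact mul_le_mul (hC x) (hC' x) (abs_nonneg _) ((abs_nonneg _).trans (hC x))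
  simp only [Pi.mul_apply] at h
  split_ifs with he
  · subst he
    rwa [integral_harmBasis_mul_self hm, div_self] at h
    rw [surfaceMeasure_real_univ]
    exact (sphereArea_pos _).ne'
  · rwa [integral_harmBasis_mul_of_ne hm hm' he, zero_div] at h

theorem tendsto_integral_harmBasis {f : ℝ → ℝ} (hf : IsAngular f) (hf0 : ContinuousAt f 0)
    {κ : ℕ → ℝ} (hκ : Tendsto κ atTop (𝓝 0)) {n : ℕ} {m : Fin (n + 2) → ℕ}
    (hm : ent m (n + 2) ≤ 1) (h0 : m ≠ 0) :
    Tendsto (fun k => ∫ x, harmBasis m x ∂altLaw (n + 2) (κ k) f) atTop (𝓝 0) := by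
  have h := tendsto_integral_harmBasis_mul hf hf0 hκ hm (m' := 0) (by simp [ent])
  simpa [harmBasis_zero, h0] using h

theorem memLp_harmBasis {n : ℕ} (m : Fin (n + 2) → ℕ) (P : Measure (USphere (n + 2)))
    [IsFiniteMeasure P] : MemLp (harmBasis m) 2 P := by
  obtain ⟨C, hC⟩ := exists_abs_harmBasis_le m
  exact MemLp.of_bound (measurable_harmBasis m).aestronglyMeasurable C (Eventually.of_forall hC)

theorem meanVec_altLaw {n k : ℕ} (hp : 2 ≤ n + 2) (hk : 1 ≤ k) (κ : ℝ) {f : ℝ → ℝ} (hf : IsAngular f) :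
    meanVec (n + 2) k (altLaw (n + 2) κ f) =
      (tCoef (n + 2) k * ∫ u, gegenbauer ((((n + 2 : ℕ) : ℝ) - 2) / 2) k
        (inner ℝ u.1 (poleVec (n + 2))) ∂altLaw (n + 2) κ f) •
        Pi.single (firstIndex hp k) 1 := by
  ext r
  rw [Pi.smul_apply, smul_eq_mul]
  by_cases hr : r = firstIndex hp k
  · subst hr
    rw [Pi.single_eq_same, mul_one, meanVec, ← integral_const_mul]
    congr 1
    ext x
    rw [inner_poleVec, show ((((n + 2 : ℕ) : ℝ) - 2) / 2) = n / 2 by push_cast; ring]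
    exact harmBasis_single hk x
  · rw [Pi.single_eq_of_ne hr, mul_zero, meanVec, integral_altLaw κ hf]
    -- If all entries beyond the first vanished, the sum condition would force the first to be `k`.
    have hj : ∃ j, 2 ≤ j ∧ ent r.1 j ≠ 0 := by
      by_contra hc
      push Not at hc
      apply hr
      have h0 : ∀ a : Fin (n + 2), a ≠ 0 → r.1 a = 0 := fun a ha => by
        have ha' : (a : ℕ) ≠ 0 := fun h => ha (Fin.ext h)
        have := hc (a + 1) (by omega)
        rwa [ent, dif_pos (by omega)] at this
      have hsum := r.2.1
      rw [Fintype.sum_eq_single 0 h0] at hsum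
      apply Subtype.ext
      ext a
      by_cases ha : a = 0
      · subst ha
        rw [hsum]
        exact (Pi.single_eq_same (M := fun _ : Fin (n + 2) => ℕ) 0 k).symm
      · rw [h0 a ha]
        exact (Pi.single_eq_of_ne (M := fun _ : Fin (n + 2) => ℕ) ha k).symm
    obtain ⟨j, hj, hrj⟩ := hj
    rw [show ∫ x, harmVec (n + 2) k x r * tilt κ f x ∂surfaceMeasure (n + 2) = 0 from
      integral_harmBasis_mul_comp_cos r.2.2 hj hrj (G := fun s => f (κ * s))
        (hf.measurable.comp (measurable_const_mul κ)), mul_zero]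

end SphereMoments

end

/-! ### Conclusion -/

open SphereMoments

theorem mainTheorem5 (p : ℕ) (hp : 2 ≤ p) (k : ℕ) (hk : 1 ≤ k)
    (κ : ℕ → ℝ) (hκpos : ∀ n, 0 < κ n) (hκ : Tendsto κ atTop (𝓝 0))
    (f : ℝ → ℝ) (hf : SphereMoments.IsAngular f) (hf0 : ContinuousAt f 0) :
    (∀ᶠ n in atTop, IsProbabilityMeasure (SphereMoments.altLaw p (κ n) f)) ∧
    (∀ n, IsProbabilityMeasure (SphereMoments.altLaw p (κ n) f) →
      (∀ (l : ℕ) (r : SphereMoments.HarmIndex p l),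
        MemLp (fun u => SphereMoments.harmVec p l u r) 2 (SphereMoments.altLaw p (κ n) f)) ∧
      SphereMoments.meanVec p k (SphereMoments.altLaw p (κ n) f) =
        (SphereMoments.tCoef p k *
          ∫ u, SphereMoments.gegenbauer (((p : ℝ) - 2) / 2) k
            (inner ℝ u.1 (SphereMoments.poleVec p)) ∂(SphereMoments.altLaw p (κ n) f)) •
          Pi.single (SphereMoments.firstIndex hp k) 1) ∧
    Tendsto (fun n => SphereMoments.covMat p k (SphereMoments.altLaw p (κ n) f)) atTop (𝓝 1) ∧
    (∀ l : ℕ, l ≠ k →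
      Tendsto (fun n => SphereMoments.crossMat p k l (SphereMoments.altLaw p (κ n) f))
        atTop (𝓝 0)) := by
  obtain ⟨d, rfl⟩ : ∃ d, p = d + 2 := ⟨p - 2, by omega⟩
  refine ⟨eventually_isProbabilityMeasure_altLaw hf hf0 hκ d,
    fun n hP => ⟨fun l r => memLp_harmBasis r.1 _, meanVec_altLaw hp hk _ hf⟩, ?_, fun l hl => ?_⟩
  · refine tendsto_pi_nhds.2 fun r => tendsto_pi_nhds.2 fun s => ?_
    -- Since `k ≥ 1`, no index of degree `k` is zero; hence both means in `E[φφ'] - E[φ] E[φ']` tend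
    -- to zero.
    have hne : ∀ r : HarmIndex (d + 2) k, r.1 ≠ 0 := fun r h => by
      have := r.2.1
      rw [h] at this
      simp at this
      omega
    have h := (tendsto_integral_harmBasis_mul hf hf0 hκ r.2.2 s.2.2).sub
      ((tendsto_integral_harmBasis hf hf0 hκ r.2.2 (hne r)).mul
        (tendsto_integral_harmBasis hf hf0 hκ s.2.2 (hne s)))
    rw [mul_zero, sub_zero] at h
    rw [Matrix.one_apply]
    simp only [← Subtype.ext_iff] at h
    refine h.congr' ?_
    filter_upwards [eventually_isProbabilityMeasure_altLaw hf hf0 hκ d] with n hP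
    exact (covariance_eq_sub (memLp_harmBasis r.1 _) (memLp_harmBasis s.1 _)).symm
  · refine tendsto_pi_nhds.2 fun r => tendsto_pi_nhds.2 fun s => ?_
    -- Equal multi-indices would have equal degrees, contrary to `l ≠ k`.
    have hrs : r.1 ≠ s.1 := fun h => by
      have h1 := r.2.1
      rw [h, s.2.1] at h1
      exact hl h1
    have h := tendsto_integral_harmBasis_mul hf hf0 hκ r.2.2 s.2.2
    rwa [if_neg hrs] at h
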